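/- Let $k$ be an algebraically closed field of characteristic zero. A fusion category over $k$ is a semisimple $k$-linear abelian rigid monoidal category with $k$-bilinear tensor product, finite-dimensional spaces of morphisms, finitely many isomorphism classes of simple objects and simple unit object; it is pointed if every simple object is invertible with respect to $\otimes$. For a finite abelian group $A$ and a function $q\colon A\to k^\times$ that is a quadratic form (that is, $q(-x)=q(x)$ and $\sigma(x,y)=q(x+y)/(q(x)q(y))$ is bimultiplicative), let $\mathcal{C}(A,q)$ denote the pointed braided fusion category over $k$, unique up to $k$-linear braided monoidal equivalence, for which $A$ is the group of isomorphism classes of simple objects under $\otimes$ and the braiding of each simple object $X_a$ in the class $a\in A$ with itself is $c_{X_a,X_a}=q(a)\,\mathrm{id}_{X_a\otimes X_a}$. Write $\widehat{A}=\mathrm{Hom}(A,k^\times)$ and $\langle\varphi,a\rangle=\varphi(a)$. **Proposition.** Let $A$ be a finite abelian group, let $q\colon A\to k^\times$ be a quadratic form, and let $\mathcal{C}=\mathcal{C}(A,q)$ be a pointed braided fusion category over $k$ with invariant $(A,q)$. Put $$Q(a,\varphi)=\langle\varphi,a\rangle\,q(a),\qquad a\in A,\ \varphi\in\widehat{A}.$$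 Then the Drinfeld center $\mathcal{Z}(\mathcal{C})$ is a pointed braided fusion category, $Q$ is a quadratic form on $A\oplus\widehat{A}$, and there is a $k$-linear braided monoidal equivalence $\mathcal{Z}(\mathcal{C})\simeq\mathcal{C}(A\oplus\widehat{A},Q)$. That is, the group of isomorphism classes of simple objects of $\mathcal{Z}(\mathcal{C})$ with the function given by self-braiding is isomorphic to $(A\oplus\widehat{A},Q)$, and $\mathcal{Z}(\mathcal{C})$ is $k$-linearly braided equivalent to every pointed braided fusion category over $k$ with this invariant. -/

import Mathlib

open CategoryTheory CategoryTheory.Limits CategoryTheory.MonoidalCategory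

noncomputable section

namespace PointedCenter

/-! ### The linear structure of the Drinfeld center

Mathlib's `Center C` has as objects the pairs of an object `X` of `C` and a half-braiding
`X ⊗ U ≅ U ⊗ X`, and the braiding of two objects of `Center C` is the half-braiding of the first.
If `C` is `k`-linear, a linear combination of morphisms of the center is again a morphism of the
center, so all operations below are those of the underlying morphisms of `C`. -/

section CenterLinear

universe w v u

variable {C : Type u} [Category.{v} C] [MonoidalCategory C] [Preadditive C] [MonoidalPreadditive C]

instance centerHomZero (X Y : Center C) : Zero (X ⟶ Y) :=
  ⟨{ f := 0, comm := fun U => by simp }⟩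

instance centerHomAdd (X Y : Center C) : Add (X ⟶ Y) :=
  ⟨fun f g =>
    { f := f.f + g.f
      comm := fun U => by simp [Preadditive.add_comp, Preadditive.comp_add] }⟩

instance centerHomNeg (X Y : Center C) : Neg (X ⟶ Y) :=
  ⟨fun f =>
    { f := -f.f
      comm := fun U => by
        have h1 : (-f.f) ▷ U = -(f.f ▷ U) := by
          rw [eq_neg_iff_add_eq_zero, ← MonoidalPreadditive.add_whiskerRight]; simp
        have h2 : U ◁ (-f.f) = -(U ◁ f.f) := by
          rw [eq_neg_iff_add_eq_zero, ← MonoidalPreadditive.whiskerLeft_add]; simp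
        rw [h1, h2, Preadditive.neg_comp, Preadditive.comp_neg, f.comm] }⟩

@[simp] theorem center_zero_f (X Y : Center C) : (0 : X ⟶ Y).f = 0 := rfl

@[simp] theorem center_add_f {X Y : Center C} (f g : X ⟶ Y) : (f + g).f = f.f + g.f := rfl

@[simp] theorem center_neg_f {X Y : Center C} (f : X ⟶ Y) : (-f).f = -f.f := rfl

instance centerHomAddCommGroup (X Y : Center C) : AddCommGroup (X ⟶ Y) where
  add_assoc f g h := by ext; simp [add_assoc]
  zero_add f := by ext; simp
  add_zero f := by ext; simp
  add_comm f g := by ext; simp [add_comm]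
  neg_add_cancel f := by ext; simp
  nsmul := nsmulRec
  zsmul := zsmulRec

instance centerPreadditive : Preadditive (Center C) where
  add_comp _ _ _ f g h := by ext; simp [Preadditive.add_comp]
  comp_add _ _ _ f g h := by ext; simp [Preadditive.comp_add]

instance centerMonoidalPreadditive : MonoidalPreadditive (Center C) where
  whiskerLeft_zero := by intros; ext; simp; rfl
  zero_whiskerRight := by intros; ext; simp; rfl
  whiskerLeft_add := by intros; ext; simp; rfl
  add_whiskerRight := by intros; ext; simp; rfl

variable (k : Type w) [Field k] [Linear k C] [MonoidalLinear k C]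

instance centerHomSMul (X Y : Center C) : SMul k (X ⟶ Y) :=
  ⟨fun r f => { f := r • f.f, comm := fun U => by simp }⟩

@[simp] theorem center_smul_f {X Y : Center C} (r : k) (f : X ⟶ Y) : (r • f).f = r • f.f := rfl

instance centerHomModule (X Y : Center C) : Module k (X ⟶ Y) where
  one_smul f := by ext; simp
  mul_smul r s f := by ext; simp [mul_smul]
  smul_zero r := by ext; simp
  smul_add r f g := by ext; simp
  add_smul r s f := by ext; simp [add_smul]
  zero_smul f := by ext; simp

instance centerLinear : Linear k (Center C) where
  homModule := fun X Y => centerHomModule k X Y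
  smul_comp _ _ _ r f g := by ext; simp
  comp_smul _ _ _ f r g := by ext; simp

instance centerMonoidalLinear : MonoidalLinear k (Center C) where
  whiskerLeft_smul := by intros; ext; simp; rfl
  smul_whiskerRight := by intros; ext; simp; rfl

end CenterLinear

/-! ### Pointed braided fusion categories -/

section Fusion

universe w v u

/-- The given preadditive structure on `C` is that of an abelian category. (This is the conjunction
of the fields of Mathlib's `Abelian`, as a property of a preadditive category.) -/
structure IsAbelian (C : Type u) [Category.{v} C] [Preadditive C] : Prop where
  hasFiniteProducts : HasFiniteProducts C
  hasKernels : HasKernels C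
  hasCokernels : HasCokernels C
  isNormalMonoCategory : IsNormalMonoCategory C
  isNormalEpiCategory : IsNormalEpiCategory C

/-- `C` is a fusion category over `k`: a `k`-linear abelian rigid monoidal category (with
`k`-bilinear tensor product) with finite-dimensional spaces of morphisms, simple unit object and
finitely many isomorphism classes of simple objects, which is semisimple, i.e. every object is a
finite direct sum of simple objects. (Hence all objects have finite length and are projective.) -/
structure IsFusionCategory (k : Type w) [Field k] (C : Type u) [Category.{v} C] [Preadditive C]
    [Linear k C] [MonoidalCategory C] [MonoidalPreadditive C] [MonoidalLinear k C] : Prop where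
  isAbelian : IsAbelian C
  rigid : Nonempty (RigidCategory C)
  finiteDimensional_hom : ∀ X Y : C, Module.Finite k (X ⟶ Y)
  simple_unit : Simple (𝟙_ C)
  finite_simples : ∃ (n : ℕ) (S : Fin n → C), ∀ X : C, Simple X → ∃ i, Nonempty (X ≅ S i)
  semisimple : ∀ X : C, ∃ (n : ℕ) (S : Fin n → C) (b : Bicone S),
    (∀ i, Simple (S i)) ∧ Nonempty b.IsBilimit ∧ Nonempty (X ≅ b.pt)

/-- An object of a monoidal category is invertible if it has a two-sided tensor inverse. -/
def IsInvertibleObject {C : Type u} [Category.{v} C] [MonoidalCategory C] (X : C) : Prop :=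
  ∃ Y : C, Nonempty (X ⊗ Y ≅ 𝟙_ C) ∧ Nonempty (Y ⊗ X ≅ 𝟙_ C)

/-- A fusion category is pointed if all its simple objects are invertible. -/
def IsPointed (C : Type u) [Category.{v} C] [Preadditive C] [MonoidalCategory C] : Prop :=
  ∀ X : C, Simple X → IsInvertibleObject X

/-- `q : A → kˣ` is a quadratic form: `q (-x) = q x`, and `σ(x, y) = q (x + y) / (q x * q y)` is
bimultiplicative. -/
structure IsQuadraticForm {k : Type w} [Field k] {A : Type u} [AddCommGroup A] (q : A → kˣ) :
    Prop where
  map_neg : ∀ x, q (-x) = q x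
  map_add_left : ∀ x y z,
    q (x + y + z) / (q (x + y) * q z) = q (x + z) / (q x * q z) * (q (y + z) / (q y * q z))
  map_add_right : ∀ x y z,
    q (x + (y + z)) / (q x * q (y + z)) = q (x + y) / (q x * q y) * (q (x + z) / (q x * q z))

universe uA

/-- The pair formed by the group of isomorphism classes of simple objects of `C` and the function
on it given by self-braiding is isomorphic to `(A, q)`: there are representatives `X a` such that
`a ↦ [X a]` is a bijection from `A` onto the isomorphism classes of simple objects, turns addition
into the tensor product, and the braiding of `X a` with itself is the scalar `q a`. -/
def HasInvariant (k : Type w) [Field k] (C : Type u) [Category.{v} C] [Preadditive C] [Linear k C]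
    [MonoidalCategory C] [BraidedCategory C] (A : Type uA) [AddCommGroup A] (q : A → kˣ) : Prop :=
  ∃ X : A → C,
    (∀ a, Simple (X a)) ∧
    (∀ S : C, Simple S → ∃ a, Nonempty (S ≅ X a)) ∧
    (∀ a b, Nonempty (X a ≅ X b) → a = b) ∧
    (∀ a b, Nonempty (X a ⊗ X b ≅ X (a + b))) ∧
    (∀ a, (β_ (X a) (X a)).hom = (q a : k) • 𝟙 (X a ⊗ X a))

/-- `C` is a category `C(A, q)`: a pointed braided fusion category over `k` whose associated group
with quadratic form is `(A, q)`. -/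
structure IsPointedBraidedFusion (k : Type w) [Field k] (C : Type u) [Category.{v} C]
    [Preadditive C] [Linear k C] [MonoidalCategory C] [MonoidalPreadditive C] [MonoidalLinear k C]
    [BraidedCategory C] (A : Type uA) [AddCommGroup A] (q : A → kˣ) : Prop where
  isFusion : IsFusionCategory k C
  isPointed : IsPointed C
  hasInvariant : HasInvariant k C A q

universe v' u'

/-- There is a `k`-linear braided monoidal equivalence `C ⥤ D`. -/
def BraidedEquivalent (k : Type w) [Field k] (C : Type u) [Category.{v} C] [Preadditive C]
    [Linear k C] [MonoidalCategory C] [BraidedCategory C] (D : Type u') [Category.{v'} D]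
    [Preadditive D] [Linear k D] [MonoidalCategory D] [BraidedCategory D] : Prop :=
  ∃ F : C ⥤ D, Nonempty F.Braided ∧ F.IsEquivalence ∧ F.Additive ∧ F.Linear k

/-- The character group `Â = Hom(A, kˣ)`, written additively. -/
abbrev CharGroup (k : Type w) [Field k] (A : Type uA) [AddCommGroup A] : Type (max uA w) :=
  A →+ Additive kˣ

/-- The function `Q(a, φ) = ⟨φ, a⟩ q(a)` on `A ⊕ Â`. -/
def centerForm {k : Type w} [Field k] {A : Type uA} [AddCommGroup A] (q : A → kˣ) :
    A × CharGroup k A → kˣ :=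
  fun p => (p.2 p.1).toMul * q p.1

end Fusion

end PointedCenter

end

namespace PointedCenter

/-! ### Abelian cocycles -/

section AbelianCocycles

variable {A M : Type*} [AddCommGroup A] [AddCommGroup M]

/-- `(ω, c)` is an abelian `3`-cocycle on `A` with values in `M`, in the sense of Eilenberg and
Mac Lane. -/
structure IsAbelianCocycle (ω : A → A → A → M) (c : A → A → M) : Prop where
  pent : ∀ x y z t, ω x y z + ω x (y + z) t + ω y z t = ω (x + y) z t + ω x y (z + t)
  hex1 : ∀ x y z, ω x y z + c x (y + z) + ω y z x = c x y + ω y x z + c x z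
  hex2 : ∀ x y z, -ω x y z + c (x + y) z - ω z x y = c y z - ω x z y + c x z

/-- `(ω, c)` is the coboundary of a function `h` of two variables. -/
def IsAbelianCoboundary (ω : A → A → A → M) (c : A → A → M) : Prop :=
  ∃ h : A → A → M, (∀ x y z, ω x y z = h y z + h x (y + z) - h x y - h (x + y) z) ∧
    ∀ x y, c x y = h y x - h x y

namespace IsAbelianCocycle

variable {ω : A → A → A → M} {c : A → A → M}

theorem comp (H : IsAbelianCocycle ω c) {G : Type*} [AddCommGroup G] (f : G →+ A) :
    IsAbelianCocycle (fun x y z => ω (f x) (f y) (f z)) (fun x y => c (f x) (f y)) where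
  pent x y z t := by simpa using H.pent (f x) (f y) (f z) (f t)
  hex1 x y z := by simpa using H.hex1 (f x) (f y) (f z)
  hex2 x y z := by simpa using H.hex2 (f x) (f y) (f z)

theorem sub_coboundary (H : IsAbelianCocycle ω c) (h : A → A → M) :
    IsAbelianCocycle (fun x y z => ω x y z - (h y z + h x (y + z) - h x y - h (x + y) z))
      (fun x y => c x y - (h y x - h x y)) where
  pent x y z t := by
    rw [add_assoc x y z, add_assoc y z t]
    linear_combination (norm := abel_nf) H.pent x y z t
  hex1 x y z := by
    rw [add_comm y x, add_comm z x]
    linear_combination (norm := abel) H.hex1 x y z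
  hex2 x y z := by
    simp only [add_comm z]
    linear_combination (norm := abel) H.hex2 x y z

theorem of_sub_coboundary (h : A → A → M)
    (H : IsAbelianCoboundary
      (fun x y z => ω x y z - (h y z + h x (y + z) - h x y - h (x + y) z))
      (fun x y => c x y - (h y x - h x y))) : IsAbelianCoboundary ω c := by
  obtain ⟨g, h1, h2⟩ := H
  dsimp only at h1 h2
  refine ⟨fun x y => g x y + h x y, fun x y z => ?_, fun x y => ?_⟩
  · dsimp only
    linear_combination (norm := abel) h1 x y z
  · dsimp only
    linear_combination (norm := abel) h2 x y

theorem symm (H : IsAbelianCocycle ω c) (hc : ∀ x, c x x = 0) (x y : A) : c x y + c y x = 0 := by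
  linear_combination (norm := abel_nf) hc (x + y) - H.hex1 (x + y) x y - H.hex2 x y x - H.hex2 x y y
    - H.pent x y x y - hc x - hc y

/-- A cocycle can be modified by a coboundary so that it vanishes as soon as one of its arguments
does. -/
theorem exists_normalized (H : IsAbelianCocycle ω c) : ∃ h : A → A → M,
    ∀ y z, ω 0 y z - (h y z + h 0 (y + z) - h 0 y - h (0 + y) z) = 0 ∧
      ω y 0 z - (h 0 z + h y (0 + z) - h y 0 - h (y + 0) z) = 0 ∧
      ω y z 0 - (h z 0 + h y (z + 0) - h y z - h (y + z) 0) = 0 := by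
  have h0 : ω 0 0 0 = 0 := by
    have := H.pent 0 0 0 0
    simp only [add_zero] at this
    linear_combination (norm := abel) this
  refine ⟨fun x y => ω 0 0 y - ω x 0 0, fun y z => ⟨?_, ?_, ?_⟩⟩
  · have := H.pent 0 0 y z
    simp only [add_zero, zero_add] at this ⊢
    linear_combination (norm := abel) this
  · have := H.pent y 0 0 z
    simp only [add_zero, zero_add] at this ⊢
    linear_combination (norm := abel) h0 + h0 - this
  · have := H.pent y z 0 0
    simp only [add_zero] at this ⊢
    linear_combination (norm := abel) this

theorem isAbelianCoboundary_int {ω : ℤ → ℤ → ℤ → M} {c : ℤ → ℤ → M} (H : IsAbelianCocycle ω c)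
    (hc : c 1 1 = 0) : IsAbelianCoboundary ω c := by
  have hrec : ∀ (g : ℤ → M) (m : M), ∃ f : ℤ → M, f 0 = m ∧ ∀ i, f (i + 1) = f i - g i := by
    intro g m
    refine ⟨fun i => m - (∑ j ∈ Finset.Ico 0 i, g j) + ∑ j ∈ Finset.Ico i 0, g j, by simp,
      fun i => ?_⟩
    rcases le_or_gt 0 i with hi | hi
    · have h1 : Finset.Ico i 0 = ∅ := Finset.Ico_eq_empty (by omega)
      have h2 : Finset.Ico (i + 1) 0 = ∅ := Finset.Ico_eq_empty (by omega)
      have h3 : Finset.Ico 0 (i + 1) = insert i (Finset.Ico 0 i) := by ext; simp; omega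
      simp only [h1, h2, h3]
      rw [Finset.sum_insert (by simp)]
      simp only [Finset.sum_empty]
      abel
    · have h1 : Finset.Ico 0 i = ∅ := Finset.Ico_eq_empty (by omega)
      have h2 : Finset.Ico 0 (i + 1) = ∅ := Finset.Ico_eq_empty (by omega)
      have h3 : Finset.Ico i 0 = insert i (Finset.Ico (i + 1) 0) := by ext; simp; omega
      simp only [h1, h2, h3]
      rw [Finset.sum_insert (by simp)]
      simp only [Finset.sum_empty]
      abel
  choose f hf0 hf using fun k : ℤ => hrec (fun i => ω 1 i k) (ω 1 0 k)
  have hf1 : ∀ k, f k 1 = 0 := fun k => by simpa [hf0] using hf k 0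
  apply of_sub_coboundary (fun i k => f k i)
  have H' := H.sub_coboundary (fun i k => f k i)
  set ω' : ℤ → ℤ → ℤ → M := fun x y z => ω x y z -
    ((fun i k => f k i) y z + (fun i k => f k i) x (y + z) - (fun i k => f k i) x y -
      (fun i k => f k i) (x + y) z) with hω'
  set c' : ℤ → ℤ → M := fun x y => c x y - ((fun i k => f k i) y x - (fun i k => f k i) x y)
    with hc'
  have h1 : ∀ y z, ω' 1 y z = 0 := by
    intro y z
    simp only [hω', hf1, add_comm (1 : ℤ) y, hf]
    abel
  have hstep : ∀ x y z, ω' (x + 1) y z = ω' x y z := by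
    intro x y z
    rw [add_comm x 1]
    linear_combination (norm := abel) h1 x y + h1 (x + y) z - h1 x (y + z) - H'.pent 1 x y z
  have hω0 : ∀ x y z, ω' x y z = 0 := by
    intro x y z
    have h0 : ω' 0 y z = 0 := by rw [← hstep, zero_add, h1]
    induction x using Int.induction_on with
    | zero => exact h0
    | succ i ih => rw [hstep, ih]
    | pred i ih => rw [← hstep, sub_add_cancel, ih]
  have hr : ∀ x y z, c' x (y + z) = c' x y + c' x z := fun x y z => by
    simpa [hω0] using H'.hex1 x y z
  have hl : ∀ x y z, c' (x + y) z = c' y z + c' x z := fun x y z => by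
    simpa [hω0] using H'.hex2 x y z
  have h11 : c' 1 1 = 0 := by simp [hc', hc]
  have h1y : ∀ y, c' 1 y = 0 := fun y =>
    DFunLike.congr_fun (AddMonoidHom.ext_int (f := AddMonoidHom.mk' (c' 1) (hr 1)) (g := 0)
      (by simpa using h11)) y
  have hxy : ∀ y x, c' x y = 0 := fun y x =>
    DFunLike.congr_fun (AddMonoidHom.ext_int
      (f := AddMonoidHom.mk' (fun x => c' x y) (fun a b => by rw [hl, add_comm])) (g := 0)
      (by simpa using h1y y)) x
  exact ⟨fun _ _ => 0, fun x y z => by simpa using hω0 x y z, fun x y => by simpa using hxy y x⟩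

theorem isAbelianCoboundary_prod (H : IsAbelianCocycle ω c) (hc : ∀ x, c x x = 0)
    {G₁ G₂ : Type*} [AddCommGroup G₁] [AddCommGroup G₂] (f₁ : G₁ →+ A) (f₂ : G₂ →+ A)
    (H₁ : IsAbelianCoboundary (fun x y z => ω (f₁ x) (f₁ y) (f₁ z)) fun x y => c (f₁ x) (f₁ y))
    (H₂ : IsAbelianCoboundary (fun x y z => ω (f₂ x) (f₂ y) (f₂ z)) fun x y => c (f₂ x) (f₂ y)) :
    IsAbelianCoboundary
      (fun x y z => ω (f₁.coprod f₂ x) (f₁.coprod f₂ y) (f₁.coprod f₂ z))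
      fun x y => c (f₁.coprod f₂ x) (f₁.coprod f₂ y) := by
  obtain ⟨h₁, hω₁, hc₁⟩ := H₁
  obtain ⟨h₂, hω₂, hc₂⟩ := H₂
  let t : A → A → A → A → M := fun a b a' b' =>
    ω a b (a' + b') - ω b a' b' + c b a' + ω a' b b' - ω a a' (b + b')
  refine ⟨fun x y => h₁ x.1 y.1 + h₂ x.2 y.2 - t (f₁ x.1) (f₂ x.2) (f₁ y.1) (f₂ y.2), ?_, ?_⟩
  · rintro ⟨x₁, y₁⟩ ⟨x₂, y₂⟩ ⟨x₃, y₃⟩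
    have e1 := hω₁ x₁ x₂ x₃
    have e2 := hω₂ y₁ y₂ y₃
    simp only [AddMonoidHom.coprod_apply, Prod.mk_add_mk, map_add, t] at e1 e2 ⊢
    generalize f₁ x₁ = a1 at *
    generalize f₁ x₂ = a2 at *
    generalize f₁ x₃ = a3 at *
    generalize f₂ y₁ = b1 at *
    generalize f₂ y₂ = b2 at *
    generalize f₂ y₃ = b3 at *
    linear_combination (norm := abel_nf) e1 + e2 - H.pent b1 a2 a3 (b2 + b3)
      + H.pent a2 b1 a3 (b2 + b3) + H.hex1 b1 a2 a3
      - H.pent a1 a2 a3 (b1 + b2 + b3) - H.pent a2 a3 b1 b2 - H.pent (a2 + a3) b1 b2 b3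
      - H.pent a2 a3 (b1 + b2) b3 + H.pent a2 (b1 + a3) b2 b3 + H.pent b1 a3 b2 b3
      + H.pent a1 b1 a2 b2 + H.pent (a1 + b1) a2 b2 (a3 + b3) - H.pent (a1 + b1 + a2) b2 a3 b3
      + H.pent a1 a2 b1 (b2 + a3 + b3) - H.pent a1 a2 b1 b2 - H.pent a1 b1 a2 (b2 + a3 + b3)
      + H.pent (a1 + a2) (b1 + b2) a3 b3 - H.pent (a1 + a2) b1 b2 a3
      - H.pent (a1 + a2) b1 (b2 + a3) b3 - H.hex2 b1 b2 a3
  · rintro ⟨x₁, y₁⟩ ⟨x₂, y₂⟩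
    have e1 := hc₁ x₁ x₂
    have e2 := hc₂ y₁ y₂
    simp only [AddMonoidHom.coprod_apply, t] at e1 e2 ⊢
    generalize f₁ x₁ = a1 at *
    generalize f₁ x₂ = a2 at *
    generalize f₂ y₁ = b1 at *
    generalize f₂ y₂ = b2 at *
    linear_combination (norm := abel_nf) e1 + e2 + H.hex1 b1 a2 b2
      - H.pent a2 b2 b1 a1 - H.hex2 b2 b1 a1 - H.symm hc b1 a1
      + H.symm hc a1 (b1 + b2) + H.hex1 (b1 + b2) a1 a2 - H.hex1 (b1 + b2) a2 a1
      + H.hex2 a1 b1 (a2 + b2) - H.hex1 a1 (a2 + b2) b1 + H.hex1 a1 (b1 + b2) a2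

end IsAbelianCocycle

/-- The set `M × K`, on which a symmetric `2`-cocycle `h` defines a twisted addition. -/
@[ext]
structure TwistedProd {K M : Type*} (h : K → K → M) where
  fst : M
  snd : K

theorem exists_eq_add_sub_of_symmetric_cocycle {K M : Type*} [AddCommGroup K] [AddCommGroup M]
    (hM : Module.Baer ℤ M) (h : K → K → M)
    (h1 : ∀ x y z, h y z + h x (y + z) = h x y + h (x + y) z) (h2 : ∀ x y, h x y = h y x) :
    ∃ ψ : K → M, ∀ x y, h x y = ψ x + ψ y - ψ (x + y) := by
  have h0 : ∀ x, h 0 x = h 0 0 := fun x => by simpa using h1 0 0 x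
  let _ : Add (TwistedProd h) := ⟨fun p q => ⟨p.1 + q.1 + h p.2 q.2, p.2 + q.2⟩⟩
  let _ : Zero (TwistedProd h) := ⟨⟨-h 0 0, 0⟩⟩
  let _ : Neg (TwistedProd h) := ⟨fun p => ⟨-p.1 - h (-p.2) p.2 - h 0 0, -p.2⟩⟩
  let _ : AddCommGroup (TwistedProd h) :=
    { AddGroup.ofLeftAxioms (G := TwistedProd h)
        (fun p q r => TwistedProd.ext
          (by
            change p.1 + q.1 + h p.2 q.2 + r.1 + h (p.2 + q.2) r.2 =
              p.1 + (q.1 + r.1 + h q.2 r.2) + h p.2 (q.2 + r.2)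
            linear_combination (norm := abel) -(h1 p.2 q.2 r.2))
          (add_assoc p.2 q.2 r.2))
        (fun p => TwistedProd.ext
          (by
            change -h 0 0 + p.1 + h 0 p.2 = p.1
            rw [h0 p.2]; abel)
          (zero_add p.2))
        (fun p => TwistedProd.ext
          (by
            change -p.1 - h (-p.2) p.2 - h 0 0 + p.1 + h (-p.2) p.2 = -h 0 0
            abel)
          (neg_add_cancel p.2)) with
      add_comm := fun p q => TwistedProd.ext
        (by
          change p.1 + q.1 + h p.2 q.2 = q.1 + p.1 + h q.2 p.2
          rw [h2, add_comm p.1])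
        (add_comm p.2 q.2) }
  have hadd : ∀ p q : TwistedProd h, p + q = ⟨p.1 + q.1 + h p.2 q.2, p.2 + q.2⟩ := fun _ _ => rfl
  let i : M →+ TwistedProd h := AddMonoidHom.mk' (fun m => ⟨m - h 0 0, 0⟩) fun m n => by
    rw [hadd]
    exact TwistedProd.ext (by dsimp only; abel) (zero_add 0).symm
  obtain ⟨r, hr⟩ := hM.extension_property_addMonoidHom i
    (fun m n hmn => sub_left_injective (congrArg TwistedProd.fst hmn)) (AddMonoidHom.id M)
  have hr' : ∀ m x, r ⟨m, x⟩ = m + r ⟨0, x⟩ := by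
    intro m x
    have e : (⟨m, x⟩ : TwistedProd h) = i m + ⟨0, x⟩ := by
      rw [hadd]
      exact TwistedProd.ext (by change m = m - h 0 0 + 0 + h 0 x; rw [h0 x]; abel)
        (zero_add x).symm
    rw [e, map_add]
    exact congrArg (· + r ⟨0, x⟩) (DFunLike.congr_fun hr m)
  refine ⟨fun x => r ⟨0, x⟩, fun x y => ?_⟩
  have e := map_add r ⟨0, x⟩ ⟨0, y⟩
  rw [hadd, hr'] at e
  dsimp only at e
  linear_combination (norm := abel) e

namespace IsAbelianCocycle

variable {ω : A → A → A → M} {c : A → A → M}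

theorem isAbelianCoboundary_of_surjective_of_normalized (H : IsAbelianCocycle ω c)
    (hM : Module.Baer ℤ M) (hω : ∀ y z, ω 0 y z = 0 ∧ ω y 0 z = 0 ∧ ω y z 0 = 0)
    {G : Type*} [AddCommGroup G] (f : G →+ A) (hf : Function.Surjective f)
    (HG : IsAbelianCoboundary (fun x y z => ω (f x) (f y) (f z)) fun x y => c (f x) (f y)) :
    IsAbelianCoboundary ω c := by
  obtain ⟨h, h1, h2⟩ : IsAbelianCoboundary
      (fun x y z => ω (f x) (f y) (f z)) fun x y => c (f x) (f y) := HG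
  wlog h00 : h 0 0 = 0 generalizing h
  · refine this (fun x y => h x y - h 0 0) (fun x y z => ?_) (fun x y => ?_) (sub_self _)
    · dsimp only
      linear_combination (norm := abel) h1 x y z
    · dsimp only
      linear_combination (norm := abel) h2 x y
  dsimp only at h1 h2
  have hc0 : ∀ y, c 0 y = 0 := fun y => by
    have := H.hex2 0 0 y
    simp only [hω, add_zero] at this
    linear_combination (norm := abel) -this
  have h0 : ∀ x, h 0 x = 0 := fun x => by
    have := h1 0 0 x
    simp only [map_zero, hω, zero_add, h00] at this
    linear_combination (norm := abel) -this
  obtain ⟨ψ, hψ⟩ := exists_eq_add_sub_of_symmetric_cocycle hM (K := f.ker) (fun x y => h x y)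
    (fun x y z => by
      have := h1 x y z
      rw [AddMonoidHom.mem_ker.1 x.2, (hω _ _).1] at this
      simp only [AddSubgroup.coe_add]
      linear_combination (norm := abel) -this)
    (fun x y => by
      have := h2 x y
      rw [AddMonoidHom.mem_ker.1 x.2, hc0] at this
      linear_combination (norm := abel) this)
  obtain ⟨s, hs, hs0⟩ : ∃ s : A → G, (∀ a, f (s a) = a) ∧ s 0 = 0 := by
    classical
    refine ⟨Function.update (Function.surjInv hf) 0 0, fun a => ?_, by simp⟩
    rcases eq_or_ne a 0 with rfl | ha
    · simp
    · simp [ha, Function.surjInv_eq]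
  let κ : G → f.ker := fun g => ⟨g - s (f g), by simp [AddMonoidHom.mem_ker, hs]⟩
  have hκ : ∀ g, s (f g) + κ g = g := fun g => by simp [κ]
  let Ψ : G → M := fun g => ψ (κ g) - h (s (f g)) (κ g)
  let h' : G → G → M := fun x y => h x y - Ψ x - Ψ y + Ψ (x + y)
  have h1' : ∀ x y z, ω (f x) (f y) (f z) = h' y z + h' x (y + z) - h' x y - h' (x + y) z := by
    intro x y z
    simp only [h', ← add_assoc]
    linear_combination (norm := abel) h1 x y z
  have h2' : ∀ x y, c (f x) (f y) = h' y x - h' x y := by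
    intro x y
    simp only [h', add_comm y x]
    linear_combination (norm := abel) h2 x y
  have hker : ∀ g (y : f.ker), h' g y = 0 := by
    intro g y
    have hy : f y = 0 := AddMonoidHom.mem_ker.1 y.2
    have e1 : κ y = y := by ext; simp [κ, hy, hs0]
    have e2 : κ (g + y) = κ g + y := by ext; simp [κ, hy]; abel
    have e3 := h1 (s (f g)) (κ g) y
    rw [hy, (hω _ _).2.2, hκ] at e3
    simp only [h', Ψ, e1, e2, hy, hs0, h0, map_add, add_zero]
    have e4 := hψ (κ g) y
    simp only [AddSubgroup.coe_add] at e3 e4 ⊢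
    linear_combination (norm := abel) e3 + e4
  have hr : ∀ x g (y : f.ker), h' x (g + y) = h' x g := by
    intro x g y
    have e := h1' x g y
    rw [AddMonoidHom.mem_ker.1 y.2, (hω _ _).2.2, hker, hker] at e
    linear_combination (norm := abel) -e
  have hl : ∀ x g (y : f.ker), h' (g + y) x = h' g x := by
    intro x g y
    have e1 := h2' x (g + y)
    have e2 := h2' x g
    rw [map_add, AddMonoidHom.mem_ker.1 y.2, add_zero, hr] at e1
    linear_combination (norm := abel) e2 - e1
  have hh : ∀ x y, h' x y = h' (s (f x)) (s (f y)) := fun x y => by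
    conv_lhs => rw [← hκ x, ← hκ y, hr, hl]
  refine ⟨fun a b => h' (s a) (s b), fun x y z => ?_, fun x y => ?_⟩
  · have e := h1' (s x) (s y) (s z)
    rw [hh (s x) (s y + s z), hh (s x + s y) (s z)] at e
    simpa only [map_add, hs] using e
  · simpa only [hs] using h2' (s x) (s y)

theorem isAbelianCoboundary_of_surjective (H : IsAbelianCocycle ω c)
    (hM : Module.Baer ℤ M) {G : Type*} [AddCommGroup G] (f : G →+ A) (hf : Function.Surjective f)
    (HG : IsAbelianCoboundary (fun x y z => ω (f x) (f y) (f z)) fun x y => c (f x) (f y)) :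
    IsAbelianCoboundary ω c := by
  obtain ⟨h, hh⟩ := H.exists_normalized
  refine of_sub_coboundary h
    ((H.sub_coboundary h).isAbelianCoboundary_of_surjective_of_normalized hM hh f hf ?_)
  obtain ⟨g, h1, h2⟩ := HG
  dsimp only at h1 h2
  refine ⟨fun x y => g x y - h (f x) (f y), fun x y z => ?_, fun x y => ?_⟩
  · simp only [map_add]
    linear_combination (norm := abel) h1 x y z
  · dsimp only
    linear_combination (norm := abel) h2 x y

/-- An abelian cocycle on a finite group with values in a divisible group is a coboundary if the
associated quadratic form vanishes. -/
theorem isAbelianCoboundary [Finite A] (H : IsAbelianCocycle ω c) (hM : Module.Baer ℤ M)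
    (hc : ∀ x, c x x = 0) : IsAbelianCoboundary ω c := by
  have key : ∀ s : Finset A, ∃ (G : Type) (_ : AddCommGroup G) (f : G →+ A),
      IsAbelianCoboundary (fun x y z => ω (f x) (f y) (f z)) (fun x y => c (f x) (f y)) ∧
        ∀ a ∈ s, ∃ g, f g = a := by
    classical
    intro s
    induction s using Finset.induction_on with
    | empty =>
      exact ⟨ℤ, inferInstance, 0, (H.comp 0).isAbelianCoboundary_int (by simp [hc]), by simp⟩
    | insert a s _ ih =>
      obtain ⟨G, _, f, hf, hs⟩ := ih
      refine ⟨G × ℤ, inferInstance, f.coprod (zmultiplesHom A a),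
        H.isAbelianCoboundary_prod hc f (zmultiplesHom A a) hf
          ((H.comp _).isAbelianCoboundary_int (by simp [hc])), ?_⟩
      intro b hb
      rcases Finset.mem_insert.1 hb with rfl | hb
      · exact ⟨(0, 1), by simp⟩
      · obtain ⟨g, rfl⟩ := hs b hb
        exact ⟨(g, 0), by simp⟩
  have := Fintype.ofFinite A
  obtain ⟨G, _, f, hf, hs⟩ := key Finset.univ
  exact H.isAbelianCoboundary_of_surjective hM f (fun a => hs a (Finset.mem_univ a)) hf

end IsAbelianCocycle

theorem baer_additive_units (k : Type*) [Field k] [IsAlgClosed k] :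
    Module.Baer ℤ (Additive kˣ) := by
  have hk : ∀ {n : ℕ}, n ≠ 0 → Function.Surjective fun a : kˣ => a ^ n := by
    intro n hn a
    obtain ⟨z, hz⟩ := IsAlgClosed.exists_pow_nat_eq (a : k) (Nat.pos_of_ne_zero hn)
    have hz0 : z ≠ 0 := by
      rintro rfl
      rw [zero_pow hn] at hz
      exact a.ne_zero hz.symm
    exact ⟨Units.mk0 z hz0, Units.ext (by simpa using hz)⟩
  let : DivisibleBy (Additive kˣ) ℕ :=
    divisibleByOfSMulRightSurj _ _ fun {n} hn a =>
      (hk hn a.toMul).imp fun _ hb => congrArg Additive.ofMul hb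
  let : DivisibleBy (Additive kˣ) ℤ := AddGroup.divisibleByIntOfDivisibleByNat _
  exact Module.Baer.of_divisible _

end AbelianCocycles

end PointedCenter

namespace PointedCenter

/-! ### Categories with a basis of simple objects -/

section SimpleBasis

universe w v u v' u' uI

/-- Morphisms exhibiting `X` as a finite direct sum of the objects `F j`. -/
structure SumData {C : Type u} [Category.{v} C] [Preadditive C] {J : Type*} [Fintype J]
    (F : J → C) (X : C) where
  ι : ∀ j, F j ⟶ X
  π : ∀ j, X ⟶ F j
  ι_π : ∀ j, ι j ≫ π j = 𝟙 (F j)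
  ι_π_ne : ∀ i j, i ≠ j → ι i ≫ π j = 0
  total : ∑ j, π j ≫ ι j = 𝟙 X

namespace SumData

variable {C : Type u} [Category.{v} C] [Preadditive C] {J : Type*} [Fintype J] {F : J → C} {X : C}

/-- Replace the summands by isomorphic ones. -/
def congr (d : SumData F X) {G : J → C} (e : ∀ j, F j ≅ G j) : SumData G X where
  ι j := (e j).inv ≫ d.ι j
  π j := d.π j ≫ (e j).hom
  ι_π j := by simp [reassoc_of% (d.ι_π j)]
  ι_π_ne i j h := by simp [reassoc_of% (d.ι_π_ne i j h)]
  total := by simp [d.total]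

/-- Replace the sum by an isomorphic object. -/
def congrRight (d : SumData F X) {Y : C} (e : X ≅ Y) : SumData F Y where
  ι j := d.ι j ≫ e.hom
  π j := e.inv ≫ d.π j
  ι_π j := by simp [d.ι_π j]
  ι_π_ne i j h := by simp [d.ι_π_ne i j h]
  total := by
    have : ∀ j, (e.inv ≫ d.π j) ≫ d.ι j ≫ e.hom = e.inv ≫ (d.π j ≫ d.ι j) ≫ e.hom := by simp
    simp only [this, ← Preadditive.comp_sum, ← Preadditive.sum_comp, d.total]
    simp

/-- Reindex a direct sum. -/
def reindex (d : SumData F X) {J' : Type*} [Fintype J'] (e : J' ≃ J) :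
    SumData (fun j => F (e j)) X where
  ι j := d.ι (e j)
  π j := d.π (e j)
  ι_π j := d.ι_π (e j)
  ι_π_ne i j h := d.ι_π_ne _ _ (e.injective.ne h)
  total := by rw [← d.total]; exact e.sum_comp (fun j => d.π j ≫ d.ι j)

/-- A direct sum of direct sums. -/
def sigma (d : SumData F X) {K : J → Type*} [∀ j, Fintype (K j)] {G : ∀ j, K j → C}
    (e : ∀ j, SumData (G j) (F j)) : SumData (fun p : Σ j, K j => G p.1 p.2) X where
  ι p := (e p.1).ι p.2 ≫ d.ι p.1
  π p := d.π p.1 ≫ (e p.1).π p.2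
  ι_π p := by simp [reassoc_of% (d.ι_π p.1), (e p.1).ι_π]
  ι_π_ne := by
    rintro ⟨i, a⟩ ⟨j, b⟩ h
    rcases eq_or_ne i j with rfl | hij
    · have hab : a ≠ b := fun h' => h (by rw [h'])
      simp [reassoc_of% (d.ι_π i), (e i).ι_π_ne a b hab]
    · simp [reassoc_of% (d.ι_π_ne i j hij)]
  total := by
    rw [← Finset.univ_sigma_univ, Finset.sum_sigma, ← d.total]
    refine Finset.sum_congr rfl fun j _ => ?_
    have : ∀ x, (d.π j ≫ (e j).π x) ≫ (e j).ι x ≫ d.ι j =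
        d.π j ≫ ((e j).π x ≫ (e j).ι x) ≫ d.ι j := by simp
    simp only [this, ← Preadditive.comp_sum, ← Preadditive.sum_comp, (e j).total]
    simp

/-- The direct sum provided by a bilimit bicone. -/
def ofBicone (b : Bicone F) (hb : b.IsBilimit) : SumData F b.pt where
  ι := b.ι
  π := b.π
  ι_π j := by simp
  ι_π_ne i j h := by rw [b.ι_π, dif_neg h]
  total := by
    classical
    exact IsBilimit.total hb

variable [DecidableEq J] in
/-- The bicone of a direct sum. -/
@[simps]
def bicone (d : SumData F X) : Bicone F where
  pt := X
  ι := d.ι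
  π := d.π
  ι_π i j := by
    split_ifs with h
    · subst h
      simpa using d.ι_π i
    · exact d.ι_π_ne i j h

variable [DecidableEq J] in
/-- The bicone of a direct sum is a bilimit. -/
def isBilimit (d : SumData F X) : d.bicone.IsBilimit := isBilimitOfTotal _ d.total

end SumData

/-- The objects `S i` are simple, pairwise non-isomorphic, with scalar endomorphisms, and every
object is a direct sum of them. -/
structure IsSimpleBasis (k : Type w) [Field k] {C : Type u} [Category.{v} C] [Preadditive C]
    [Linear k C] {I : Type uI} (S : I → C) : Prop where
  id_ne_zero : ∀ i, 𝟙 (S i) ≠ 0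
  schur : ∀ i (f : S i ⟶ S i), ∃ c : k, f = c • 𝟙 (S i)
  hom_eq_zero : ∀ i j, i ≠ j → ∀ f : S i ⟶ S j, f = 0
  exists_sumData : ∀ X, ∃ (n : ℕ) (s : Fin n → I), Nonempty (SumData (fun j => S (s j)) X)

namespace IsSimpleBasis

variable {k : Type w} [Field k] {C : Type u} [Category.{v} C] [Preadditive C]
    [Linear k C] {I : Type uI} {S : I → C}

theorem comp_induction (H : IsSimpleBasis k S) {i j : I} (f : S i ⟶ S j)
    {P : ∀ {i j : I}, (S i ⟶ S j) → Prop} (h0 : ∀ i j, P (0 : S i ⟶ S j))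
    (h1 : ∀ i (c : k), P (c • 𝟙 (S i))) : P f := by
  rcases eq_or_ne i j with rfl | h
  · obtain ⟨c, rfl⟩ := H.schur i f
    exact h1 i c
  · rw [H.hom_eq_zero i j h f]
    exact h0 i j

variable {D : Type u'} [Category.{v'} D] [Preadditive D]

theorem hom_ext_map (H : IsSimpleBasis k S) (G : C ⥤ D) [G.Additive] {X : C} {Z : D}
    {f g : G.obj X ⟶ Z} (h : ∀ i (u : S i ⟶ X), G.map u ≫ f = G.map u ≫ g) : f = g := by
  obtain ⟨n, s, ⟨d⟩⟩ := H.exists_sumData X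
  rw [← Category.id_comp f, ← Category.id_comp g, ← G.map_id, ← d.total, G.map_sum,
    Preadditive.sum_comp, Preadditive.sum_comp]
  simp [h]

theorem hom_ext (H : IsSimpleBasis k S) {X Z : C} {f g : X ⟶ Z}
    (h : ∀ i (u : S i ⟶ X), u ≫ f = u ≫ g) : f = g :=
  H.hom_ext_map (𝟭 C) h

theorem natTrans_ext (H : IsSimpleBasis k S) {G G' : C ⥤ D} [G.Additive] {t t' : G ⟶ G'}
    (h : ∀ i, t.app (S i) = t'.app (S i)) : t = t' := by
  ext X
  refine H.hom_ext_map G fun i u => ?_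
  rw [t.naturality, t'.naturality, h]

theorem exists_natTrans [Linear k D] (H : IsSimpleBasis k S) (G G' : C ⥤ D) [G.Additive]
    [G'.Additive] [G.Linear k] [G'.Linear k] (t : ∀ i, G.obj (S i) ⟶ G'.obj (S i)) :
    ∃ T : G ⟶ G', ∀ i, T.app (S i) = t i := by
  have nat : ∀ {i j : I} (f : S i ⟶ S j), G.map f ≫ t j = t i ≫ G'.map f := fun f =>
    H.comp_induction f (P := fun {i j} f => G.map f ≫ t j = t i ≫ G'.map f) (by simp)
      (by simp [Functor.map_smul])
  choose n s d using H.exists_sumData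
  replace d := fun X => (d X).some
  let T : ∀ X, G.obj X ⟶ G'.obj X := fun X =>
    ∑ j, G.map ((d X).π j) ≫ t (s X j) ≫ G'.map ((d X).ι j)
  have hT : ∀ X i (u : S i ⟶ X), G.map u ≫ T X = t i ≫ G'.map u := by
    intro X i u
    have h1 : ∀ j, G.map u ≫ G.map ((d X).π j) ≫ t (s X j) ≫ G'.map ((d X).ι j) =
        t i ≫ G'.map u ≫ G'.map ((d X).π j ≫ (d X).ι j) := by
      intro j
      rw [← G.map_comp_assoc, reassoc_of% (nat (u ≫ (d X).π j)), ← G'.map_comp, ← G'.map_comp,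
        Category.assoc]
    simp only [T, Preadditive.comp_sum, h1]
    rw [← Preadditive.comp_sum, ← Preadditive.comp_sum, ← G'.map_sum, (d X).total]
    simp
  refine ⟨{ app := T, naturality := fun X Y f => ?_ }, fun i => ?_⟩
  · refine H.hom_ext_map G fun i u => ?_
    rw [← G.map_comp_assoc, hT, reassoc_of% (hT X i u), G'.map_comp]
  · simpa using hT (S i) i (𝟙 _)

theorem exists_natIso [Linear k D] (H : IsSimpleBasis k S) (G G' : C ⥤ D) [G.Additive]
    [G'.Additive] [G.Linear k] [G'.Linear k] (t : ∀ i, G.obj (S i) ≅ G'.obj (S i)) :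
    ∃ T : G ≅ G', ∀ i, T.hom.app (S i) = (t i).hom := by
  obtain ⟨T, hT⟩ := H.exists_natTrans G G' fun i => (t i).hom
  obtain ⟨T', hT'⟩ := H.exists_natTrans G' G fun i => (t i).inv
  exact ⟨⟨T, T', H.natTrans_ext (by simp [hT, hT']), H.natTrans_ext (by simp [hT, hT'])⟩, hT⟩

theorem simple (H : IsSimpleBasis k S) (i : I) : Simple (S i) where
  mono_isIso_iff_nonzero {Y} f _ := by
    refine ⟨fun _ h => H.id_ne_zero i ?_, fun hf => ?_⟩
    · rw [← IsIso.inv_hom_id f, ← comp_zero (f := inv f) (Z := S i), ← h]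
    · obtain ⟨j, u, hu⟩ : ∃ j, ∃ u : S j ⟶ Y, u ≫ f ≠ 0 := by
        by_contra! h
        exact hf (H.hom_ext fun j u => by rw [h, comp_zero])
      have hj : j = i := by
        by_contra hj
        exact hu (H.hom_eq_zero _ _ hj _)
      subst hj
      obtain ⟨c, hc⟩ := H.schur j (u ≫ f)
      have hc0 : c ≠ 0 := by
        rintro rfl
        exact hu (by rw [hc, zero_smul])
      have : IsSplitEpi f := ⟨⟨⟨c⁻¹ • u, by rw [Linear.smul_comp, hc, smul_smul,
        inv_mul_cancel₀ hc0, one_smul]⟩⟩⟩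
      exact isIso_of_mono_of_isSplitEpi f

theorem exists_iso_of_simple (H : IsSimpleBasis k S) (X : C) [Simple X] :
    ∃ i, Nonempty (X ≅ S i) := by
  obtain ⟨n, s, ⟨d⟩⟩ := H.exists_sumData X
  rcases n.eq_zero_or_pos with rfl | hn
  · exact absurd (by simpa using d.total.symm) (id_nonzero X)
  · have : IsSplitMono (d.ι ⟨0, hn⟩) := ⟨⟨⟨d.π ⟨0, hn⟩, d.ι_π _⟩⟩⟩
    have : IsIso (d.ι ⟨0, hn⟩) := isIso_of_mono_of_nonzero fun h =>
      H.id_ne_zero (s ⟨0, hn⟩) (by rw [← d.ι_π, h, zero_comp])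
    exact ⟨_, ⟨(asIso (d.ι ⟨0, hn⟩)).symm⟩⟩

theorem eq_of_iso (H : IsSimpleBasis k S) {i j : I} (e : S i ≅ S j) : i = j := by
  by_contra h
  exact H.id_ne_zero i (by rw [← e.hom_inv_id, H.hom_eq_zero _ _ h e.hom, zero_comp])

theorem finrank_hom (H : IsSimpleBasis k S) [DecidableEq I] (i j : I) :
    Module.finrank k (S i ⟶ S j) = if i = j then 1 else 0 := by
  split_ifs with h
  · subst h
    exact finrank_eq_one _ (H.id_ne_zero i) fun f => (H.schur i f).imp fun _ h => h.symm
  · have : Subsingleton (S i ⟶ S j) :=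
      ⟨fun f g => by rw [H.hom_eq_zero _ _ h f, H.hom_eq_zero _ _ h g]⟩
    exact Module.finrank_zero_of_subsingleton

theorem finite_hom_basis (H : IsSimpleBasis k S) (i j : I) : Module.Finite k (S i ⟶ S j) := by
  rcases eq_or_ne i j with rfl | h
  · exact Module.Finite.of_surjective (LinearMap.toSpanSingleton k _ (𝟙 (S i)))
      fun f => (H.schur i f).imp fun _ h => h.symm
  · have : Subsingleton (S i ⟶ S j) :=
      ⟨fun f g => by rw [H.hom_eq_zero _ _ h f, H.hom_eq_zero _ _ h g]⟩
    infer_instance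

variable (k) in
/-- Morphisms to a direct sum are families of morphisms to the summands. -/
def _root_.PointedCenter.SumData.homEquiv {J : Type*} [Fintype J] {F : J → C} {X : C}
    (d : SumData F X) (Y : C) : (Y ⟶ X) ≃ₗ[k] ∀ j, Y ⟶ F j where
  toFun f j := f ≫ d.π j
  map_add' f g := by ext; simp
  map_smul' c f := by ext; simp
  invFun g := ∑ j, g j ≫ d.ι j
  left_inv f := by simp [← Preadditive.comp_sum, d.total]
  right_inv g := by
    ext j
    dsimp only
    rw [Preadditive.sum_comp, Finset.sum_eq_single j]
    · simp [d.ι_π]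
    · intro b _ hb
      simp [d.ι_π_ne b j hb]
    · simp

theorem finite_hom_left (H : IsSimpleBasis k S) (i : I) (X : C) : Module.Finite k (S i ⟶ X) := by
  obtain ⟨n, s, ⟨d⟩⟩ := H.exists_sumData X
  have := fun j => H.finite_hom_basis i (s j)
  exact Module.Finite.equiv (d.homEquiv k (S i)).symm

theorem finite_hom (H : IsSimpleBasis k S) (X Y : C) : Module.Finite k (X ⟶ Y) := by
  obtain ⟨n, s, ⟨d⟩⟩ := H.exists_sumData X
  have := fun j => H.finite_hom_left (s j) Y
  let f : (X ⟶ Y) →ₗ[k] ∀ j, S (s j) ⟶ Y :=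
    { toFun := fun g j => d.ι j ≫ g
      map_add' := by intros; ext; simp
      map_smul' := by intros; ext; simp }
  refine Module.Finite.of_injective f fun g g' h => ?_
  rw [← Category.id_comp g, ← Category.id_comp g', ← d.total, Preadditive.sum_comp,
    Preadditive.sum_comp]
  refine Finset.sum_congr rfl fun j _ => ?_
  simpa [f] using congrArg (d.π j ≫ ·) (congrFun h j)

theorem finrank_hom_sumData (H : IsSimpleBasis k S) [DecidableEq I] {J : Type*} [Fintype J]
    {s : J → I} {X : C} (d : SumData (fun j => S (s j)) X) (i : I) :
    Module.finrank k (S i ⟶ X) = Fintype.card {j // s j = i} := by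
  have := fun j => H.finite_hom_basis i (s j)
  rw [(d.homEquiv k (S i)).finrank_eq, Module.finrank_pi_fintype, Fintype.card_subtype,
    Finset.card_filter]
  exact Finset.sum_congr rfl fun j _ => by rw [H.finrank_hom]; simp [eq_comm]

/-- The functor sending an object to its multiplicity spaces. -/
@[simps]
def multiplicity (H : IsSimpleBasis k S) : C ⥤ Discrete I ⥤ FGModuleCat.{max v v'} k where
  obj X := Discrete.functor fun i =>
    have := H.finite_hom_left i X
    FGModuleCat.of k (ULift.{v'} (S i ⟶ X))
  map {X Y} f := Discrete.natTrans fun i =>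
    have := H.finite_hom_left i.as X
    have := H.finite_hom_left i.as Y
    FGModuleCat.ofHom (ULift.moduleEquiv.symm.toLinearMap ∘ₗ (Linear.rightComp k (S i.as) f) ∘ₗ
      ULift.moduleEquiv.toLinearMap)
  map_id X := by
    ext i u
    exact ULift.ext _ _ (Category.comp_id u.down)
  map_comp f g := by
    ext i u
    exact ULift.ext _ _ (Category.assoc u.down f g).symm

theorem multiplicity_map_apply (H : IsSimpleBasis k S) {X Y : C} (f : X ⟶ Y) (i : I)
    (u : S i ⟶ X) :
    ((H.multiplicity.{w, v, u, v'}.map f).app ⟨i⟩).hom.hom (ULift.up u) = ULift.up (u ≫ f) := rfl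

instance (H : IsSimpleBasis k S) : H.multiplicity.{w, v, u, v'}.Additive where
  map_add {X Y f g} := by
    ext i u
    exact ULift.ext _ _ (Preadditive.comp_add _ _ _ u.down f g)

instance (H : IsSimpleBasis k S) : H.multiplicity.{w, v, u, v'}.Linear k where
  map_smul f c := by
    ext i u
    exact ULift.ext _ _ (Linear.comp_smul _ _ _ u.down c f)

instance (H : IsSimpleBasis k S) : H.multiplicity.{w, v, u, v'}.Faithful where
  map_injective {X Y f g} h := H.hom_ext fun i u => ULift.up_injective (by
    rw [← H.multiplicity_map_apply.{w, v, u, v'} f, ← H.multiplicity_map_apply.{w, v, u, v'} g, h])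

instance (H : IsSimpleBasis k S) : H.multiplicity.{w, v, u, v'}.Full where
  map_surjective {X Y} T := by
    obtain ⟨n, s, ⟨d⟩⟩ := H.exists_sumData X
    let t : ∀ i, (S i ⟶ X) →ₗ[k] (S i ⟶ Y) := fun i =>
      ULift.moduleEquiv.toLinearMap ∘ₗ (T.app ⟨i⟩).hom.hom ∘ₗ ULift.moduleEquiv.symm.toLinearMap
    have ht : ∀ {i j : I} (f : S i ⟶ S j) (u : S j ⟶ X), t i (f ≫ u) = f ≫ t j u := fun f =>
      H.comp_induction f (P := fun {i j} f => ∀ u, t i (f ≫ u) = f ≫ t j u) (by simp) (by simp)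
    refine ⟨∑ j, d.π j ≫ t (s j) (d.ι j), ?_⟩
    ext ⟨i⟩ u
    refine ULift.ext _ _ (?_ : u.down ≫ (∑ j, d.π j ≫ t (s j) (d.ι j)) = t i u.down)
    conv_rhs => rw [← Category.comp_id u.down, ← d.total, Preadditive.comp_sum, map_sum]
    simp only [← Category.assoc, ht, Preadditive.comp_sum]

variable [HasFiniteBiproducts C] [Finite I]

instance (H : IsSimpleBasis k S) : H.multiplicity.{w, v, u, v'}.EssSurj where
  mem_essImage M := by
    classical
    have := Fintype.ofFinite I
    let F : (Σ i : I, Fin (Module.finrank k (M.obj ⟨i⟩))) → C := fun p => S p.1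
    let d : SumData F (⨁ F) := SumData.ofBicone _ (biproduct.isBilimit F)
    refine ⟨⨁ F, ⟨Discrete.natIso fun i => ?_⟩⟩
    have := H.finite_hom_left i.as (⨁ F)
    refine (LinearEquiv.ofFinrankEq (ULift.{v'} (S i.as ⟶ ⨁ F)) (M.obj i) ?_).toFGModuleCatIso
    rw [LinearEquiv.finrank_eq ULift.moduleEquiv, H.finrank_hom_sumData d]
    rw [Fintype.card_congr (Equiv.sigmaSubtype i.as), Fintype.card_fin]

instance (H : IsSimpleBasis k S) : H.multiplicity.{w, v, u, v'}.IsEquivalence where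

theorem isAbelian (H : IsSimpleBasis k S) : IsAbelian C := by
  have : HasFiniteProducts C := inferInstance
  let _ : Abelian C := abelianOfEquivalence H.multiplicity.{w, v, u, v}
  exact ⟨inferInstance, inferInstance, inferInstance, inferInstance, inferInstance⟩

theorem isFusionCategory [MonoidalCategory C] [MonoidalPreadditive C] [MonoidalLinear k C]
    (H : IsSimpleBasis k S) (hr : Nonempty (RigidCategory C)) (i : I)
    (hi : Nonempty (𝟙_ C ≅ S i)) : IsFusionCategory k C where
  isAbelian := H.isAbelian
  rigid := hr
  finiteDimensional_hom := H.finite_hom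
  simple_unit := by
    obtain ⟨e⟩ := hi
    have := H.simple i
    exact Simple.of_iso e
  finite_simples := by
    obtain ⟨n, ⟨e⟩⟩ := Finite.exists_equiv_fin I
    refine ⟨n, fun j => S (e.symm j), fun X _ => ?_⟩
    obtain ⟨i, hi⟩ := H.exists_iso_of_simple X
    exact ⟨e i, by simpa using hi⟩
  semisimple X := by
    obtain ⟨n, s, ⟨d⟩⟩ := H.exists_sumData X
    exact ⟨n, fun j => S (s j), d.bicone, fun j => H.simple _, ⟨d.isBilimit⟩, ⟨Iso.refl _⟩⟩

/-- Categories with bases of simple objects indexed by the same finite set are equivalent. -/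
theorem exists_equivalence [Linear k D] [HasFiniteBiproducts D] {T : I → D}
    (H : IsSimpleBasis k S) (H' : IsSimpleBasis k T) :
    ∃ F : C ⥤ D, F.IsEquivalence ∧ F.Additive ∧ F.Linear k ∧ ∀ i, Nonempty (F.obj (S i) ≅ T i) := by
  let V := H.multiplicity.{w, v, u, v'}
  let V' := H'.multiplicity.{w, v', u', v}
  have : V'.asEquivalence.functor.Additive := inferInstanceAs V'.Additive
  have : V'.asEquivalence.functor.Linear k := inferInstanceAs (V'.Linear k)
  have : V'.asEquivalence.inverse.Linear k := Equivalence.inverseLinear k V'.asEquivalence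
  refine ⟨V ⋙ V'.asEquivalence.inverse, inferInstance, inferInstance, inferInstance,
    fun i => ⟨V'.preimageIso (V'.asEquivalence.counitIso.app (V.obj (S i)) ≪≫
      Discrete.natIso fun j => ?_)⟩⟩
  classical
  have := H.finite_hom_left j.as (S i)
  have := H'.finite_hom_left j.as (T i)
  refine (LinearEquiv.ofFinrankEq (ULift.{v'} (S j.as ⟶ S i))
    (ULift.{v} (T j.as ⟶ T i)) ?_).toFGModuleCatIso
  rw [LinearEquiv.finrank_eq ULift.moduleEquiv, LinearEquiv.finrank_eq ULift.moduleEquiv,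
    H.finrank_hom, H'.finrank_hom]

end IsSimpleBasis

/-- The basis of simple objects of a fusion category. -/
theorem IsFusionCategory.isSimpleBasis {k : Type w} [Field k] [IsAlgClosed k] {C : Type u}
    [Category.{v} C] [Preadditive C] [Linear k C] [MonoidalCategory C] [MonoidalPreadditive C]
    [MonoidalLinear k C] (hC : IsFusionCategory k C) {I : Type uI} (S : I → C)
    (hS : ∀ i, Simple (S i)) (hS' : ∀ X : C, Simple X → ∃ i, Nonempty (X ≅ S i))
    (hinj : ∀ i j, Nonempty (S i ≅ S j) → i = j) : IsSimpleBasis k S where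
  id_ne_zero i := id_nonzero (S i)
  schur i f := by
    have := hC.isAbelian.hasKernels
    have := hC.finiteDimensional_hom
    obtain ⟨c, hc⟩ := endomorphism_simple_eq_smul_id k f
    exact ⟨c, hc.symm⟩
  hom_eq_zero i j h f := by
    have := hC.isAbelian.hasKernels
    by_contra hf
    have := isIso_of_hom_simple hf
    exact h (hinj i j ⟨asIso f⟩)
  exists_sumData X := by
    obtain ⟨n, T, b, hT, ⟨hb⟩, ⟨e⟩⟩ := hC.semisimple X
    choose s hs using fun j => hS' (T j) (hT j)
    exact ⟨n, s, ⟨((SumData.ofBicone b hb).congr fun j => (hs j).some).congrRight e.symm⟩⟩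

end SimpleBasis

end PointedCenter

set_option linter.unusedSectionVars false

namespace PointedCenter

/-! ### Braided functors on categories with a basis of simple objects -/

section Tensorator

universe w v u v' u' uA

variable {C : Type u} [Category.{v} C] [MonoidalCategory C]
  {D : Type u'} [Category.{v'} D] [MonoidalCategory D]

/-- A natural isomorphism `F X ⊗ F Y ≅ F (X ⊗ Y)`, without any coherence condition. -/
structure Tensorator (F : C ⥤ D) where
  μ : ∀ X Y, F.obj X ⊗ F.obj Y ≅ F.obj (X ⊗ Y)
  nat_left : ∀ {X X' : C} (f : X ⟶ X') (Y : C),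
    F.map f ▷ F.obj Y ≫ (μ X' Y).hom = (μ X Y).hom ≫ F.map (f ▷ Y)
  nat_right : ∀ (X : C) {Y Y' : C} (f : Y ⟶ Y'),
    F.obj X ◁ F.map f ≫ (μ X Y').hom = (μ X Y).hom ≫ F.map (X ◁ f)

namespace Tensorator

variable {F : C ⥤ D} (t : Tensorator F)

theorem nat_left_assoc {X X' : C} (f : X ⟶ X') (Y : C) {W : D} (h : F.obj (X' ⊗ Y) ⟶ W) :
    F.map f ▷ F.obj Y ≫ (t.μ X' Y).hom ≫ h = (t.μ X Y).hom ≫ F.map (f ▷ Y) ≫ h := by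
  rw [reassoc_of% (t.nat_left f Y)]

theorem nat_right_assoc (X : C) {Y Y' : C} (f : Y ⟶ Y') {W : D} (h : F.obj (X ⊗ Y') ⟶ W) :
    F.obj X ◁ F.map f ≫ (t.μ X Y').hom ≫ h = (t.μ X Y).hom ≫ F.map (X ◁ f) ≫ h := by
  rw [reassoc_of% (t.nat_right X f)]

/-- The composite `(F X ⊗ F Y) ⊗ F Z ⟶ F ((X ⊗ Y) ⊗ Z) ⟶ F (X ⊗ (Y ⊗ Z))`. -/
def assocLeft (X Y Z : C) : (F.obj X ⊗ F.obj Y) ⊗ F.obj Z ≅ F.obj (X ⊗ Y ⊗ Z) :=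
  whiskerRightIso (t.μ X Y) (F.obj Z) ≪≫ t.μ (X ⊗ Y) Z ≪≫ F.mapIso (α_ X Y Z)

/-- The composite `(F X ⊗ F Y) ⊗ F Z ⟶ F X ⊗ (F Y ⊗ F Z) ⟶ F (X ⊗ (Y ⊗ Z))`. -/
def assocRight (X Y Z : C) : (F.obj X ⊗ F.obj Y) ⊗ F.obj Z ≅ F.obj (X ⊗ Y ⊗ Z) :=
  α_ _ _ _ ≪≫ whiskerLeftIso (F.obj X) (t.μ Y Z) ≪≫ t.μ X (Y ⊗ Z)

theorem assocLeft_hom (X Y Z : C) : (t.assocLeft X Y Z).hom =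
    (t.μ X Y).hom ▷ F.obj Z ≫ (t.μ (X ⊗ Y) Z).hom ≫ F.map (α_ X Y Z).hom := rfl

theorem assocRight_hom (X Y Z : C) : (t.assocRight X Y Z).hom =
    (α_ _ _ _).hom ≫ F.obj X ◁ (t.μ Y Z).hom ≫ (t.μ X (Y ⊗ Z)).hom := rfl

theorem naturality {X X' Y Y' : C} (f : X ⟶ X') (g : Y ⟶ Y') :
    (F.map f ⊗ₘ F.map g) ≫ (t.μ X' Y').hom = (t.μ X Y).hom ≫ F.map (f ⊗ₘ g) := by
  rw [MonoidalCategory.tensorHom_def, MonoidalCategory.tensorHom_def, Category.assoc, t.nat_right,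
    t.nat_left_assoc, F.map_comp]

theorem naturality_assoc {X X' Y Y' : C} (f : X ⟶ X') (g : Y ⟶ Y') {W : D}
    (h : F.obj (X' ⊗ Y') ⟶ W) :
    (F.map f ⊗ₘ F.map g) ≫ (t.μ X' Y').hom ≫ h = (t.μ X Y).hom ≫ F.map (f ⊗ₘ g) ≫ h := by
  rw [reassoc_of% (t.naturality f g)]

theorem assocLeft_naturality {X X' Y Y' Z Z' : C} (f : X ⟶ X') (g : Y ⟶ Y') (h : Z ⟶ Z') :
    ((F.map f ⊗ₘ F.map g) ⊗ₘ F.map h) ≫ (t.assocLeft X' Y' Z').hom =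
      (t.assocLeft X Y Z).hom ≫ F.map (f ⊗ₘ g ⊗ₘ h) := by
  rw [assocLeft_hom, assocLeft_hom, ← tensorHom_id, tensorHom_comp_tensorHom_assoc, naturality,
    Category.comp_id, ← whiskerRight_comp_tensorHom, Category.assoc, naturality_assoc,
    ← F.map_comp, associator_naturality]
  simp only [Category.assoc, F.map_comp]

theorem assocRight_naturality {X X' Y Y' Z Z' : C} (f : X ⟶ X') (g : Y ⟶ Y') (h : Z ⟶ Z') :
    ((F.map f ⊗ₘ F.map g) ⊗ₘ F.map h) ≫ (t.assocRight X' Y' Z').hom =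
      (t.assocRight X Y Z).hom ≫ F.map (f ⊗ₘ g ⊗ₘ h) := by
  rw [assocRight_hom, assocRight_hom, associator_naturality_assoc, ← id_tensorHom,
    tensorHom_comp_tensorHom_assoc, naturality, Category.comp_id, ← whiskerLeft_comp_tensorHom,
    Category.assoc, naturality]
  simp only [Category.assoc]

variable [BraidedCategory C] [BraidedCategory D]

/-- The composite `F X ⊗ F Y ⟶ F (X ⊗ Y) ⟶ F (Y ⊗ X)`. -/
def braidLeft (X Y : C) : F.obj X ⊗ F.obj Y ≅ F.obj (Y ⊗ X) :=
  t.μ X Y ≪≫ F.mapIso (β_ X Y)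

/-- The composite `F X ⊗ F Y ⟶ F Y ⊗ F X ⟶ F (Y ⊗ X)`. -/
def braidRight (X Y : C) : F.obj X ⊗ F.obj Y ≅ F.obj (Y ⊗ X) :=
  β_ _ _ ≪≫ t.μ Y X

theorem braidLeft_hom (X Y : C) :
    (t.braidLeft X Y).hom = (t.μ X Y).hom ≫ F.map (β_ X Y).hom := rfl

theorem braidRight_hom (X Y : C) :
    (t.braidRight X Y).hom = (β_ _ _).hom ≫ (t.μ Y X).hom := rfl

theorem braidLeft_naturality {X X' Y Y' : C} (f : X ⟶ X') (g : Y ⟶ Y') :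
    (F.map f ⊗ₘ F.map g) ≫ (t.braidLeft X' Y').hom =
      (t.braidLeft X Y).hom ≫ F.map (g ⊗ₘ f) := by
  rw [braidLeft_hom, braidLeft_hom, t.naturality_assoc, Category.assoc, ← F.map_comp,
    ← F.map_comp, BraidedCategory.braiding_naturality]

theorem braidRight_naturality {X X' Y Y' : C} (f : X ⟶ X') (g : Y ⟶ Y') :
    (F.map f ⊗ₘ F.map g) ≫ (t.braidRight X' Y').hom =
      (t.braidRight X Y).hom ≫ F.map (g ⊗ₘ f) := by
  rw [braidRight_hom, braidRight_hom, BraidedCategory.braiding_naturality_assoc, t.naturality,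
    Category.assoc]

/-- A tensorator compatible with associators and braidings makes the functor braided. -/
theorem nonempty_braided (t : Tensorator F) (e : 𝟙_ D ≅ F.obj (𝟙_ C))
    (he : (e.hom ▷ F.obj (𝟙_ C)) ≫ (t.μ (𝟙_ C) (𝟙_ C)).hom ≫ F.map (λ_ (𝟙_ C)).hom =
      (λ_ (F.obj (𝟙_ C))).hom)
    (h1 : ∀ X Y Z, (t.assocLeft X Y Z).hom = (t.assocRight X Y Z).hom)
    (h2 : ∀ X Y, (t.braidLeft X Y).hom = (t.braidRight X Y).hom) : Nonempty F.Braided := by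
  have hl : ∀ X : C, (e.hom ▷ F.obj X) ≫ (t.μ (𝟙_ C) X).hom ≫ F.map (λ_ X).hom =
      (λ_ (F.obj X)).hom := by
    intro X
    have he' : (e.hom ▷ F.obj (𝟙_ C)) ≫ (t.μ (𝟙_ C) (𝟙_ C)).hom =
        (λ_ (F.obj (𝟙_ C))).hom ≫ F.map (λ_ (𝟙_ C)).inv := by
      rw [← he]
      simp
    have e1 : ((e.hom ▷ F.obj (𝟙_ C)) ▷ F.obj X) ≫ (t.assocLeft (𝟙_ C) (𝟙_ C) X).hom =
        (α_ _ _ _).hom ≫ (𝟙_ D ◁ (t.μ (𝟙_ C) X).hom) ≫ (λ_ (F.obj (𝟙_ C ⊗ X))).hom ≫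
          F.map (λ_ (𝟙_ C ⊗ X)).inv := by
      rw [assocLeft_hom, ← comp_whiskerRight_assoc, he', comp_whiskerRight_assoc,
        t.nat_left_assoc, ← F.map_comp, leftUnitor_naturality_assoc, leftUnitor_whiskerRight]
      simp
    rw [h1, assocRight_hom, associator_naturality_left_assoc, ← whisker_exchange_assoc] at e1
    replace e1 := (cancel_epi _).1 ((cancel_epi _).1 e1)
    have e2 : (e.hom ▷ F.obj (𝟙_ C ⊗ X)) ≫ (t.μ (𝟙_ C) (𝟙_ C ⊗ X)).hom =
        (𝟙_ D ◁ F.map (λ_ X).hom) ≫ (e.hom ▷ F.obj X) ≫ (t.μ (𝟙_ C) X).hom ≫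
          F.map (𝟙_ C ◁ (λ_ X).inv) := by
      rw [whisker_exchange_assoc, t.nat_right_assoc, ← F.map_comp,
        ← MonoidalCategory.whiskerLeft_comp]
      simp
    rw [e2] at e1
    rw [← cancel_epi (𝟙_ D ◁ F.map (λ_ X).hom), leftUnitor_naturality]
    have e3 := congrArg (· ≫ F.map (𝟙_ C ◁ (λ_ X).hom ≫ (λ_ X).hom)) e1
    simp only [Category.assoc, ← F.map_comp] at e3
    rw [← MonoidalCategory.whiskerLeft_comp_assoc] at e3
    simpa using e3
  have hr : ∀ X : C, (F.obj X ◁ e.hom) ≫ (t.μ X (𝟙_ C)).hom ≫ F.map (ρ_ X).hom =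
      (ρ_ (F.obj X)).hom := by
    intro X
    have e1 := h2 X (𝟙_ C)
    rw [braidLeft_hom, braidRight_hom] at e1
    have e2 : (ρ_ X).hom = (β_ X (𝟙_ C)).hom ≫ (λ_ X).hom := by simp
    rw [e2, F.map_comp, reassoc_of% e1, BraidedCategory.braiding_naturality_right_assoc, hl]
    simp
  let core : F.CoreMonoidal :=
    { εIso := e
      μIso := t.μ
      μIso_hom_natural_left := fun f Y => t.nat_left f Y
      μIso_hom_natural_right := fun X f => t.nat_right X f
      associativity := h1
      left_unitality := fun X => (hl X).symm
      right_unitality := fun X => (hr X).symm }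
  let _ := core.toMonoidal
  exact ⟨{ braided := fun X Y => h2 X Y }⟩

variable [Preadditive C] [MonoidalPreadditive C] [Preadditive D] [MonoidalPreadditive D]
  {k : Type w} [Field k] [Linear k C] [MonoidalLinear k C] [Linear k D] [MonoidalLinear k D]
  {A : Type uA} [AddCommGroup A] {S : A → C} {T : A → D}

theorem exists_tensorator (H : IsSimpleBasis k S) (F : C ⥤ D) [F.Additive] [F.Linear k]
    (K : ∀ a b, F.obj (S a) ⊗ F.obj (S b) ≅ F.obj (S a ⊗ S b)) :
    ∃ t : Tensorator F, ∀ a b, t.μ (S a) (S b) = K a b := by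
  choose r hr using fun b =>
    H.exists_natIso (F ⋙ tensorRight (F.obj (S b))) (tensorRight (S b) ⋙ F) fun a => K a b
  choose l hl using fun X : C =>
    H.exists_natIso (F ⋙ tensorLeft (F.obj X)) (tensorLeft X ⋙ F) fun b => (r b).app X
  refine ⟨⟨fun X Y => (l X).app Y, fun {X X'} f Y => ?_, fun X {Y Y'} f => (l X).hom.naturality f⟩,
    fun a b => Iso.ext ?_⟩
  · refine H.hom_ext_map (F ⋙ tensorLeft (F.obj X)) fun b u => ?_
    have e1 : ∀ X : C, (F.obj X ◁ F.map u) ≫ (l X).hom.app Y =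
        (r b).hom.app X ≫ F.map (X ◁ u) := fun X => by
      have := (l X).hom.naturality u
      rw [hl] at this
      exact this
    have e2 : (F.map f ▷ F.obj (S b)) ≫ (r b).hom.app X' =
      (r b).hom.app X ≫ F.map (f ▷ S b) := (r b).hom.naturality f
    change (F.obj X ◁ F.map u) ≫ (F.map f ▷ F.obj Y) ≫ (l X').hom.app Y =
      (F.obj X ◁ F.map u) ≫ (l X).hom.app Y ≫ F.map (f ▷ Y)
    rw [whisker_exchange_assoc, e1, reassoc_of% e2, reassoc_of% (e1 X), ← F.map_comp,
      ← F.map_comp, whisker_exchange]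
  · exact (hl (S a) b).trans (hr b a)

variable (k) in
/-- The associativity of the tensorator holds on `X`, `Y`, `Z` up to the scalar `c`. -/
def AssocScalar (X Y Z : C) (c : kˣ) : Prop :=
  (t.assocLeft X Y Z).hom = (c : k) • (t.assocRight X Y Z).hom

variable (k) in
/-- The compatibility of the tensorator with the braiding holds on `X`, `Y` up to the scalar `c`. -/
def BraidScalar (X Y : C) (c : kˣ) : Prop :=
  (t.braidLeft X Y).hom = (c : k) • (t.braidRight X Y).hom

variable {t}

theorem AssocScalar.of_iso [F.Linear k] {X X' Y Y' Z Z' : C} {c : kˣ}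
    (h : t.AssocScalar k X Y Z c) (f : X ≅ X') (g : Y ≅ Y') (p : Z ≅ Z') :
    t.AssocScalar k X' Y' Z' c := by
  have e1 := t.assocLeft_naturality f.hom g.hom p.hom
  have e2 := t.assocRight_naturality f.hom g.hom p.hom
  rw [AssocScalar] at h ⊢
  rw [← cancel_epi ((F.map f.hom ⊗ₘ F.map g.hom) ⊗ₘ F.map p.hom), e1, h, Linear.comp_smul, e2,
    Linear.smul_comp]

theorem BraidScalar.of_iso [F.Linear k] {X X' Y Y' : C} {c : kˣ}
    (h : t.BraidScalar k X Y c) (f : X ≅ X') (g : Y ≅ Y') : t.BraidScalar k X' Y' c := by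
  have e1 := t.braidLeft_naturality f.hom g.hom
  have e2 := t.braidRight_naturality f.hom g.hom
  rw [BraidScalar] at h ⊢
  rw [← cancel_epi (F.map f.hom ⊗ₘ F.map g.hom), e1, h, Linear.comp_smul, e2, Linear.smul_comp]

theorem AssocScalar.pentagon [F.Linear k] {X Y Z W : C} {c₁ c₂ c₃ c₄ c₅ : kˣ}
    (h₁ : t.AssocScalar k X Y Z c₁) (h₂ : t.AssocScalar k X (Y ⊗ Z) W c₂)
    (h₃ : t.AssocScalar k Y Z W c₃) (h₄ : t.AssocScalar k (X ⊗ Y) Z W c₄)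
    (h₅ : t.AssocScalar k X Y (Z ⊗ W) c₅) :
    ∃ f : ((F.obj X ⊗ F.obj Y) ⊗ F.obj Z) ⊗ F.obj W ≅ F.obj (X ⊗ Y ⊗ Z ⊗ W),
      ((c₁ * c₂ * c₃ : kˣ) : k) • f.hom = ((c₄ * c₅ : kˣ) : k) • f.hom := by
  rw [AssocScalar, assocLeft_hom, assocRight_hom] at h₁ h₂ h₃ h₄ h₅
  refine ⟨α_ _ _ _ ≪≫ α_ _ _ _ ≪≫ whiskerLeftIso _ (whiskerLeftIso _ (t.μ Z W)) ≪≫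
    whiskerLeftIso _ (t.μ Y (Z ⊗ W)) ≪≫ t.μ X (Y ⊗ Z ⊗ W), ?_⟩
  trans ((t.μ X Y).hom ▷ F.obj Z ▷ F.obj W) ≫ ((t.μ (X ⊗ Y) Z).hom ▷ F.obj W) ≫
    (t.μ ((X ⊗ Y) ⊗ Z) W).hom ≫ F.map ((α_ X Y Z).hom ▷ W) ≫ F.map (α_ X (Y ⊗ Z) W).hom ≫
      F.map (X ◁ (α_ Y Z W).hom)
  · have e1 : ((t.μ X Y).hom ▷ F.obj Z ▷ F.obj W) ≫ ((t.μ (X ⊗ Y) Z).hom ▷ F.obj W) ≫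
        (F.map (α_ X Y Z).hom ▷ F.obj W) = (c₁ : k) • (((α_ _ _ _).hom ▷ F.obj W) ≫
          ((F.obj X ◁ (t.μ Y Z).hom) ▷ F.obj W) ≫ ((t.μ X (Y ⊗ Z)).hom ▷ F.obj W)) := by
      simp only [← comp_whiskerRight, ← MonoidalLinear.smul_whiskerRight, h₁]
    have e3 : (F.obj X ◁ ((t.μ Y Z).hom ▷ F.obj W)) ≫ (F.obj X ◁ (t.μ (Y ⊗ Z) W).hom) ≫
        (F.obj X ◁ F.map (α_ Y Z W).hom) = (c₃ : k) • ((F.obj X ◁ (α_ _ _ _).hom) ≫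
          (F.obj X ◁ (F.obj Y ◁ (t.μ Z W).hom)) ≫ (F.obj X ◁ (t.μ Y (Z ⊗ W)).hom)) := by
      simp only [← MonoidalCategory.whiskerLeft_comp, ← MonoidalLinear.whiskerLeft_smul, h₃]
    rw [← t.nat_left_assoc, reassoc_of% e1, Linear.smul_comp]
    simp only [Category.assoc]
    rw [reassoc_of% h₂]
    simp only [Linear.smul_comp, Linear.comp_smul, Category.assoc]
    rw [← t.nat_right, associator_naturality_middle_assoc, reassoc_of% e3]
    simp only [Linear.smul_comp, Linear.comp_smul, Category.assoc, smul_smul, Units.val_mul]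
    simp [mul_assoc]
  · rw [← F.map_comp, ← F.map_comp, MonoidalCategory.pentagon, F.map_comp, reassoc_of% h₄]
    simp only [Linear.smul_comp, Linear.comp_smul, Category.assoc]
    rw [associator_naturality_left_assoc, ← whisker_exchange_assoc, h₅]
    simp only [Linear.comp_smul, smul_smul, Units.val_mul]
    congr 1
    simp

theorem hexagon_forward [F.Linear k] {X Y Z : C} {c₁ c₂ c₃ d₁ d₂ d₃ : kˣ}
    (h₁ : t.AssocScalar k X Y Z c₁) (h₂ : t.AssocScalar k Y Z X c₂)
    (h₃ : t.AssocScalar k Y X Z c₃) (g₁ : t.BraidScalar k X (Y ⊗ Z) d₁)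
    (g₂ : t.BraidScalar k X Y d₂) (g₃ : t.BraidScalar k X Z d₃) :
    ∃ f : (F.obj X ⊗ F.obj Y) ⊗ F.obj Z ≅ F.obj (Y ⊗ Z ⊗ X),
      ((c₁ * d₁ * c₂ : kˣ) : k) • f.hom = ((d₂ * c₃ * d₃ : kˣ) : k) • f.hom := by
  rw [AssocScalar, assocLeft_hom, assocRight_hom] at h₁ h₂ h₃
  rw [BraidScalar, braidLeft_hom, braidRight_hom] at g₁ g₂ g₃
  refine ⟨α_ _ _ _ ≪≫ β_ _ _ ≪≫ α_ _ _ _ ≪≫ whiskerLeftIso _ (t.μ Z X) ≪≫ t.μ Y (Z ⊗ X), ?_⟩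
  trans ((t.μ X Y).hom ▷ F.obj Z) ≫ (t.μ (X ⊗ Y) Z).hom ≫ F.map (α_ X Y Z).hom ≫
    F.map (β_ X (Y ⊗ Z)).hom ≫ F.map (α_ Y Z X).hom
  · rw [reassoc_of% h₁]
    simp only [Linear.smul_comp, Category.assoc]
    rw [reassoc_of% g₁]
    simp only [Linear.smul_comp, Linear.comp_smul, Category.assoc]
    rw [BraidedCategory.braiding_naturality_right_assoc, h₂]
    simp only [Linear.comp_smul, smul_smul, Units.val_mul]
    simp [mul_assoc]
  · have e2 : ((t.μ X Y).hom ▷ F.obj Z) ≫ (F.map (β_ X Y).hom ▷ F.obj Z) =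
        (d₂ : k) • (((β_ _ _).hom ▷ F.obj Z) ≫ ((t.μ Y X).hom ▷ F.obj Z)) := by
      simp only [← comp_whiskerRight, ← MonoidalLinear.smul_whiskerRight, g₂]
    have e3 : (F.obj Y ◁ (t.μ X Z).hom) ≫ (F.obj Y ◁ F.map (β_ X Z).hom) =
        (d₃ : k) • ((F.obj Y ◁ (β_ _ _).hom) ≫ (F.obj Y ◁ (t.μ Z X).hom)) := by
      simp only [← MonoidalCategory.whiskerLeft_comp, ← MonoidalLinear.whiskerLeft_smul, g₃]
    rw [← F.map_comp, ← F.map_comp, BraidedCategory.hexagon_forward, F.map_comp, F.map_comp,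
      ← t.nat_left_assoc, reassoc_of% e2]
    simp only [Linear.smul_comp, Category.assoc]
    rw [reassoc_of% h₃]
    simp only [Linear.smul_comp, Linear.comp_smul, Category.assoc]
    rw [← t.nat_right, reassoc_of% e3]
    simp only [Linear.smul_comp, Linear.comp_smul, Category.assoc, smul_smul, Units.val_mul]
    simp [mul_assoc]

theorem AssocScalar.symm' [F.Linear k] {X Y Z : C} {c : kˣ} (h : t.AssocScalar k X Y Z c) :
    (F.obj X ◁ (t.μ Y Z).hom) ≫ (t.μ X (Y ⊗ Z)).hom ≫ F.map (α_ X Y Z).inv =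
      ((c⁻¹ : kˣ) : k) • ((α_ _ _ _).inv ≫ ((t.μ X Y).hom ▷ F.obj Z) ≫ (t.μ (X ⊗ Y) Z).hom) := by
  rw [AssocScalar, assocLeft_hom, assocRight_hom] at h
  rw [← cancel_mono (F.map (α_ X Y Z).hom), ← cancel_epi (α_ (F.obj X) (F.obj Y) (F.obj Z)).hom]
  simp only [Linear.smul_comp, Linear.comp_smul, Category.assoc, ← F.map_comp, Iso.inv_hom_id,
    Iso.hom_inv_id_assoc, F.map_id, Category.comp_id, h, smul_smul, Units.inv_mul, one_smul]

theorem hexagon_reverse [F.Linear k] {X Y Z : C} {c₁ c₂ c₃ d₁ d₂ d₃ : kˣ}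
    (h₁ : t.AssocScalar k X Y Z c₁) (h₂ : t.AssocScalar k Z X Y c₂)
    (h₃ : t.AssocScalar k X Z Y c₃) (g₁ : t.BraidScalar k (X ⊗ Y) Z d₁)
    (g₂ : t.BraidScalar k Y Z d₂) (g₃ : t.BraidScalar k X Z d₃) :
    ∃ f : F.obj X ⊗ F.obj Y ⊗ F.obj Z ≅ F.obj ((Z ⊗ X) ⊗ Y),
      ((c₁⁻¹ * d₁ * c₂⁻¹ : kˣ) : k) • f.hom = ((d₂ * c₃⁻¹ * d₃ : kˣ) : k) • f.hom := by
  replace h₁ := h₁.symm'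
  replace h₂ := h₂.symm'
  replace h₃ := h₃.symm'
  rw [BraidScalar, braidLeft_hom, braidRight_hom] at g₁ g₂ g₃
  refine ⟨(α_ _ _ _).symm ≪≫ β_ _ _ ≪≫ (α_ _ _ _).symm ≪≫ whiskerRightIso (t.μ Z X) _ ≪≫
    t.μ (Z ⊗ X) Y, ?_⟩
  trans (F.obj X ◁ (t.μ Y Z).hom) ≫ (t.μ X (Y ⊗ Z)).hom ≫ F.map (α_ X Y Z).inv ≫
    F.map (β_ (X ⊗ Y) Z).hom ≫ F.map (α_ Z X Y).inv
  · rw [reassoc_of% h₁]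
    simp only [Linear.smul_comp, Category.assoc]
    rw [reassoc_of% g₁]
    simp only [Linear.smul_comp, Linear.comp_smul, Category.assoc]
    rw [BraidedCategory.braiding_naturality_left_assoc, h₂]
    simp only [Linear.comp_smul, smul_smul, Units.val_mul]
    simp [mul_assoc]
  · have e2 : (F.obj X ◁ (t.μ Y Z).hom) ≫ (F.obj X ◁ F.map (β_ Y Z).hom) =
        (d₂ : k) • ((F.obj X ◁ (β_ _ _).hom) ≫ (F.obj X ◁ (t.μ Z Y).hom)) := by
      simp only [← MonoidalCategory.whiskerLeft_comp, ← MonoidalLinear.whiskerLeft_smul, g₂]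
    have e3 : ((t.μ X Z).hom ▷ F.obj Y) ≫ (F.map (β_ X Z).hom ▷ F.obj Y) =
        (d₃ : k) • (((β_ _ _).hom ▷ F.obj Y) ≫ ((t.μ Z X).hom ▷ F.obj Y)) := by
      simp only [← comp_whiskerRight, ← MonoidalLinear.smul_whiskerRight, g₃]
    rw [← F.map_comp, ← F.map_comp, BraidedCategory.hexagon_reverse, F.map_comp, F.map_comp,
      ← t.nat_right_assoc, reassoc_of% e2]
    simp only [Linear.smul_comp, Category.assoc]
    rw [reassoc_of% h₃]
    simp only [Linear.smul_comp, Linear.comp_smul, Category.assoc]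
    rw [← t.nat_left, reassoc_of% e3]
    simp only [Linear.smul_comp, Linear.comp_smul, Category.assoc, smul_smul, Units.val_mul]
    simp [mul_assoc]

end Tensorator

end Tensorator

end PointedCenter

set_option linter.unusedSectionVars false

namespace PointedCenter

section Uniqueness

universe w v u v' u' uA

theorem IsSimpleBasis.exists_eq_smul {k : Type w} [Field k] {D : Type u'} [Category.{v'} D]
    [Preadditive D] [Linear k D] {I : Type uA} {T : I → D} (H : IsSimpleBasis k T) {i : I}
    {W W' : D} (e : W ≅ T i) (f g : W ≅ W') : ∃ c : kˣ, f.hom = (c : k) • g.hom := by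
  obtain ⟨c, hc⟩ := H.schur i (e.inv ≫ f.hom ≫ g.inv ≫ e.hom)
  have h1 : f.hom = c • g.hom := by
    rw [← cancel_epi e.inv, ← cancel_mono (g.inv ≫ e.hom), Category.assoc, hc]
    simp
  have h2 : c ≠ 0 := by
    rintro rfl
    rw [zero_smul] at h1
    refine H.id_ne_zero i ?_
    rw [← e.inv_hom_id, ← Category.id_comp e.hom, ← f.hom_inv_id, h1]
    simp
  exact ⟨Units.mk0 c h2, h1⟩

theorem IsSimpleBasis.smul_injective {k : Type w} [Field k] {D : Type u'} [Category.{v'} D]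
    [Preadditive D] [Linear k D] {I : Type uA} {T : I → D} (H : IsSimpleBasis k T) {i : I}
    {W W' : D} (e : W ≅ T i) (f : W ≅ W') {c c' : kˣ}
    (h : (c : k) • f.hom = (c' : k) • f.hom) : c = c' := by
  have h1 : ((c : k) - c') • 𝟙 (T i) = 0 := by
    have : e.inv ≫ f.hom ≫ f.inv ≫ e.hom = 𝟙 (T i) := by simp
    rw [← this, ← Linear.comp_smul, ← Linear.smul_comp, sub_smul, h, sub_self, zero_comp,
      comp_zero]
  exact Units.ext (sub_eq_zero.1 ((smul_eq_zero.1 h1).resolve_right (H.id_ne_zero i)))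

/-- Rescale an isomorphism. -/
@[simps]
def smulIso {k : Type w} [Field k] {D : Type u'} [Category.{v'} D] [Preadditive D] [Linear k D]
    {X Y : D} (c : kˣ) (e : X ≅ Y) : X ≅ Y where
  hom := (c : k) • e.hom
  inv := ((c⁻¹ : kˣ) : k) • e.inv
  hom_inv_id := by rw [Linear.smul_comp, Linear.comp_smul, smul_smul]; simp
  inv_hom_id := by rw [Linear.smul_comp, Linear.comp_smul, smul_smul]; simp

variable {C : Type u} [Category.{v} C] [MonoidalCategory C] [BraidedCategory C]
  {D : Type u'} [Category.{v'} D] [MonoidalCategory D] [BraidedCategory D]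
  [Preadditive C] [MonoidalPreadditive C] [Preadditive D] [MonoidalPreadditive D]
  {k : Type w} [Field k] [Linear k C] [MonoidalLinear k C] [Linear k D] [MonoidalLinear k D]
  {A : Type uA} [AddCommGroup A] {S : A → C} {T : A → D}

theorem IsSimpleBasis.nonempty_unit_iso (H : IsSimpleBasis k S)
    (hS : ∀ a b, Nonempty (S a ⊗ S b ≅ S (a + b))) (h1 : Simple (𝟙_ C)) :
    Nonempty (𝟙_ C ≅ S 0) := by
  obtain ⟨z, ⟨e⟩⟩ := H.exists_iso_of_simple (𝟙_ C)
  obtain ⟨m⟩ := hS z z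
  have hz : z + z = z := H.eq_of_iso (m.symm ≪≫ (e.symm ⊗ᵢ e.symm) ≪≫ λ_ _ ≪≫ e)
  rw [add_eq_left] at hz
  subst hz
  exact ⟨e⟩

namespace Tensorator

variable {F : C ⥤ D} [F.Additive] [F.Linear k]

theorem tensor_hom_ext (H : IsSimpleBasis k S) {X Y : C} {W : D}
    {f g : F.obj X ⊗ F.obj Y ⟶ W}
    (h : ∀ a b (x : S a ⟶ X) (y : S b ⟶ Y),
      (F.map x ⊗ₘ F.map y) ≫ f = (F.map x ⊗ₘ F.map y) ≫ g) : f = g := by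
  refine H.hom_ext_map (F ⋙ tensorRight (F.obj Y)) fun a x => ?_
  refine H.hom_ext_map (F ⋙ tensorLeft (F.obj (S a))) fun b y => ?_
  have := h a b x y
  rw [MonoidalCategory.tensorHom_def'] at this
  simpa using this

theorem tensor_hom_ext₃ (H : IsSimpleBasis k S) {X Y Z : C} {W : D}
    {f g : (F.obj X ⊗ F.obj Y) ⊗ F.obj Z ⟶ W}
    (h : ∀ a b c (x : S a ⟶ X) (y : S b ⟶ Y) (z : S c ⟶ Z),
      ((F.map x ⊗ₘ F.map y) ⊗ₘ F.map z) ≫ f = ((F.map x ⊗ₘ F.map y) ⊗ₘ F.map z) ≫ g) :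
    f = g := by
  refine H.hom_ext_map (F ⋙ tensorRight (F.obj Y) ⋙ tensorRight (F.obj Z)) fun a x => ?_
  refine H.hom_ext_map (F ⋙ tensorLeft (F.obj (S a)) ⋙ tensorRight (F.obj Z)) fun b y => ?_
  refine H.hom_ext_map (F ⋙ tensorLeft (F.obj (S a) ⊗ F.obj (S b))) fun c z => ?_
  have := h a b c x y z
  rw [MonoidalCategory.tensorHom_def', MonoidalCategory.tensorHom_def', comp_whiskerRight] at this
  simpa using this

/-- If the tensorator is coherent on the objects of a basis, it is coherent. -/
theorem assoc_of_basis (H : IsSimpleBasis k S) (t : Tensorator F)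
    (h : ∀ a b c, t.AssocScalar k (S a) (S b) (S c) 1) (X Y Z : C) :
    (t.assocLeft X Y Z).hom = (t.assocRight X Y Z).hom := by
  refine tensor_hom_ext₃ H fun a b c x y z => ?_
  have := h a b c
  rw [AssocScalar, Units.val_one, one_smul] at this
  rw [assocLeft_naturality, assocRight_naturality, this]

theorem braid_of_basis (H : IsSimpleBasis k S) (t : Tensorator F)
    (h : ∀ a b, t.BraidScalar k (S a) (S b) 1) (X Y : C) :
    (t.braidLeft X Y).hom = (t.braidRight X Y).hom := by
  refine tensor_hom_ext H fun a b x y => ?_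
  have := h a b
  rw [BraidScalar, Units.val_one, one_smul] at this
  rw [braidLeft_naturality, braidRight_naturality, this]

theorem mu_eq_smul_of_iso {t t' : Tensorator F} {X X' Y Y' : C} {c : kˣ}
    (h : (t'.μ X Y).hom = (c : k) • (t.μ X Y).hom) (f : X ≅ X') (g : Y ≅ Y') :
    (t'.μ X' Y').hom = (c : k) • (t.μ X' Y').hom := by
  rw [← cancel_epi (F.map f.hom ⊗ₘ F.map g.hom), t'.naturality, h, Linear.comp_smul, t.naturality,
    Linear.smul_comp]

/-- The defects of coherence of a tensorator form an abelian cocycle. -/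
theorem exists_isAbelianCocycle (H' : IsSimpleBasis k T)
    (hS : ∀ a b, Nonempty (S a ⊗ S b ≅ S (a + b)))
    (hT : ∀ a b, Nonempty (T a ⊗ T b ≅ T (a + b)))
    (hF : ∀ a, Nonempty (F.obj (S a) ≅ T a)) (t : Tensorator F) :
    ∃ (ω : A → A → A → Additive kˣ) (c : A → A → Additive kˣ), IsAbelianCocycle ω c ∧
      (∀ x y z, t.AssocScalar k (S x) (S y) (S z) (ω x y z).toMul) ∧
      ∀ x y, t.BraidScalar k (S x) (S y) (c x y).toMul := by
  let m := fun a b => (hS a b).some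
  let m₂ : ∀ a b, F.obj (S a) ⊗ F.obj (S b) ≅ T (a + b) := fun a b =>
    ((hF a).some ⊗ᵢ (hF b).some) ≪≫ (hT a b).some
  let m₃ : ∀ a b c, (F.obj (S a) ⊗ F.obj (S b)) ⊗ F.obj (S c) ≅ T (a + b + c) := fun a b c =>
    (m₂ a b ⊗ᵢ (hF c).some) ≪≫ (hT _ _).some
  let m₄ : ∀ a b c d, ((F.obj (S a) ⊗ F.obj (S b)) ⊗ F.obj (S c)) ⊗ F.obj (S d) ≅
    T (a + b + c + d) := fun a b c d => (m₃ a b c ⊗ᵢ (hF d).some) ≪≫ (hT _ _).some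
  choose ω hω using fun x y z => H'.exists_eq_smul (m₃ x y z) (t.assocLeft (S x) (S y) (S z))
    (t.assocRight (S x) (S y) (S z))
  choose c hc using fun x y => H'.exists_eq_smul (m₂ x y) (t.braidLeft (S x) (S y))
    (t.braidRight (S x) (S y))
  replace hω : ∀ x y z, t.AssocScalar k (S x) (S y) (S z) (ω x y z) := hω
  replace hc : ∀ x y, t.BraidScalar k (S x) (S y) (c x y) := hc
  refine ⟨fun x y z => Additive.ofMul (ω x y z), fun x y => Additive.ofMul (c x y),
    ⟨fun x y z w => ?_, fun x y z => ?_, fun x y z => ?_⟩, hω, hc⟩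
  · obtain ⟨f, hf⟩ := (hω x y z).pentagon
      ((hω x (y + z) w).of_iso (Iso.refl _) (m y z).symm (Iso.refl _)) (hω y z w)
      ((hω (x + y) z w).of_iso (m x y).symm (Iso.refl _) (Iso.refl _))
      ((hω x y (z + w)).of_iso (Iso.refl _) (Iso.refl _) (m z w).symm)
    exact congrArg Additive.ofMul (H'.smul_injective (m₄ x y z w) f hf)
  · obtain ⟨f, hf⟩ := hexagon_forward (hω x y z) (hω y z x) (hω y x z)
      ((hc x (y + z)).of_iso (Iso.refl _) (m y z).symm) (hc x y) (hc x z)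
    exact congrArg Additive.ofMul (H'.smul_injective (m₃ x y z) f hf)
  · obtain ⟨f, hf⟩ := hexagon_reverse (hω x y z) (hω z x y) (hω x z y)
      ((hc (x + y) z).of_iso (m x y).symm (Iso.refl _)) (hc y z) (hc x z)
    have := congrArg Additive.ofMul
      (H'.smul_injective ((α_ _ _ _).symm ≪≫ m₃ x y z) f hf)
    simpa only [sub_eq_add_neg, ofMul_mul, ofMul_inv] using this

/-- A tensorator whose defects of coherence form a coboundary can be made coherent. -/
theorem exists_coherent (H : IsSimpleBasis k S)
    (hS : ∀ a b, Nonempty (S a ⊗ S b ≅ S (a + b))) (t : Tensorator F)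
    {ω : A → A → A → Additive kˣ} {c : A → A → Additive kˣ}
    (hω : ∀ x y z, t.AssocScalar k (S x) (S y) (S z) (ω x y z).toMul)
    (hc : ∀ x y, t.BraidScalar k (S x) (S y) (c x y).toMul) (hb : IsAbelianCoboundary ω c) :
    ∃ t' : Tensorator F, (∀ X Y Z, (t'.assocLeft X Y Z).hom = (t'.assocRight X Y Z).hom) ∧
      ∀ X Y, (t'.braidLeft X Y).hom = (t'.braidRight X Y).hom := by
  obtain ⟨h, h1, h2⟩ := hb
  obtain ⟨t', ht'⟩ := exists_tensorator H F fun a b => smulIso (h a b).toMul (t.μ (S a) (S b))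
  have ht : ∀ a b {X Y : C} (_ : X ≅ S a) (_ : Y ≅ S b),
      (t'.μ X Y).hom = ((h a b).toMul : k) • (t.μ X Y).hom := fun a b X Y f g =>
    mu_eq_smul_of_iso (by rw [ht', smulIso_hom]) f.symm g.symm
  refine ⟨t', assoc_of_basis H t' fun x y z => ?_, braid_of_basis H t' fun x y => ?_⟩
  · have e := hω x y z
    rw [AssocScalar, assocLeft_hom, assocRight_hom] at e ⊢
    rw [ht x y (Iso.refl _) (Iso.refl _), ht (x + y) z (hS x y).some (Iso.refl _),
      ht y z (Iso.refl _) (Iso.refl _), ht x (y + z) (Iso.refl _) (hS y z).some]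
    simp only [MonoidalLinear.smul_whiskerRight, MonoidalLinear.whiskerLeft_smul,
      Linear.smul_comp, Linear.comp_smul, e, smul_smul, Units.val_one, one_mul]
    congr 1
    have e2 := congrArg Additive.toMul (h1 x y z)
    simp only [toMul_sub, toMul_add] at e2
    rw [e2]
    simp only [← Units.val_mul]
    congr 1
    simp [div_eq_mul_inv, mul_comm, mul_left_comm]
  · have e := hc x y
    rw [BraidScalar, braidLeft_hom, braidRight_hom] at e ⊢
    rw [ht x y (Iso.refl _) (Iso.refl _), ht y x (Iso.refl _) (Iso.refl _)]
    simp only [Linear.smul_comp, Linear.comp_smul, e, smul_smul, Units.val_one, one_mul]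
    congr 1
    have e2 := congrArg Additive.toMul (h2 x y)
    simp only [toMul_sub] at e2
    rw [e2]
    simp only [← Units.val_mul]
    congr 1
    simp

end Tensorator

/-- Pointed braided fusion categories with the same quadratic form are braided equivalent. -/
theorem IsPointedBraidedFusion.braidedEquivalent [IsAlgClosed k] [Finite A] {q : A → kˣ}
    (hC : IsPointedBraidedFusion k C A q) (hD : IsPointedBraidedFusion k D A q) :
    BraidedEquivalent k C D := by
  obtain ⟨S, hS₁, hS₂, hS₃, hS, hSq⟩ := hC.hasInvariant
  obtain ⟨T, hT₁, hT₂, hT₃, hT, hTq⟩ := hD.hasInvariant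
  have H := hC.isFusion.isSimpleBasis S hS₁ hS₂ hS₃
  have H' := hD.isFusion.isSimpleBasis T hT₁ hT₂ hT₃
  have := hC.isFusion.isAbelian.hasFiniteProducts
  have := hD.isFusion.isAbelian.hasFiniteProducts
  have : HasFiniteBiproducts C := HasFiniteBiproducts.of_hasFiniteProducts
  have : HasFiniteBiproducts D := HasFiniteBiproducts.of_hasFiniteProducts
  obtain ⟨F, hF, _, _, hFS⟩ := H.exists_equivalence H'
  let m : ∀ a b, F.obj (S a) ⊗ F.obj (S b) ≅ F.obj (S a ⊗ S b) := fun a b =>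
    ((hFS a).some ⊗ᵢ (hFS b).some) ≪≫ (hT a b).some ≪≫ (hFS (a + b)).some.symm ≪≫
      F.mapIso (hS a b).some.symm
  obtain ⟨t, -⟩ := Tensorator.exists_tensorator H F m
  obtain ⟨ω, c, hωc, hω, hc⟩ := Tensorator.exists_isAbelianCocycle H' hS hT hFS t
  have hcc : ∀ x, c x x = 0 := by
    intro x
    have e := hc x x
    have e1 : (β_ (F.obj (S x)) (F.obj (S x))).hom = (q x : k) • 𝟙 _ := by
      have e2 := BraidedCategory.braiding_naturality (hFS x).some.hom (hFS x).some.hom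
      rw [hTq, Linear.comp_smul, Category.comp_id] at e2
      rw [← cancel_mono ((hFS x).some.hom ⊗ₘ (hFS x).some.hom), ← e2, Linear.smul_comp,
        Category.id_comp]
    rw [Tensorator.BraidScalar, Tensorator.braidLeft_hom, Tensorator.braidRight_hom, hSq, e1,
      F.map_smul, F.map_id, Linear.comp_smul, Linear.smul_comp, smul_smul, ← Units.val_mul,
      Category.comp_id, Category.id_comp] at e
    have := H'.smul_injective (((hFS x).some ⊗ᵢ (hFS x).some) ≪≫ (hT x x).some) _ e
    exact congrArg Additive.ofMul (right_eq_mul.1 this)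
  obtain ⟨t', h1, h2⟩ := t.exists_coherent H hS hω hc
    (hωc.isAbelianCoboundary (baer_additive_units k) hcc)
  obtain ⟨u⟩ := H.nonempty_unit_iso hS hC.isFusion.simple_unit
  obtain ⟨u'⟩ := H'.nonempty_unit_iso hT hD.isFusion.simple_unit
  let e : 𝟙_ D ≅ F.obj (𝟙_ C) := u' ≪≫ (hFS 0).some.symm ≪≫ F.mapIso u.symm
  obtain ⟨r, hr⟩ := H'.exists_eq_smul (λ_ _ ≪≫ e.symm ≪≫ u') (λ_ (F.obj (𝟙_ C)))
    (whiskerRightIso e (F.obj (𝟙_ C)) ≪≫ t'.μ _ _ ≪≫ F.mapIso (λ_ (𝟙_ C)))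
  refine ⟨F, t'.nonempty_braided (smulIso r e) ?_ h1 h2, hF, inferInstance, inferInstance⟩
  rw [hr, smulIso_hom, MonoidalLinear.smul_whiskerRight, Linear.smul_comp]
  rfl

end Uniqueness

end PointedCenter

namespace PointedCenter

/-! ### Characters of a finite abelian group -/

section Characters

universe w uA

variable {k : Type w} [Field k] {A : Type uA} [AddCommGroup A]

theorem sum_char_eq_zero [Fintype A] {χ : CharGroup k A} (h : χ ≠ 0) :
    ∑ a, ((χ a).toMul : k) = 0 := by
  obtain ⟨b, hb⟩ : ∃ b, χ b ≠ 0 := by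
    by_contra! h'
    exact h (AddMonoidHom.ext h')
  have hb' : ((χ b).toMul : k) ≠ 1 := fun h' => hb (by
    rw [← ofMul_toMul (χ b), Units.ext (v := 1) h', ofMul_one])
  refine eq_zero_of_mul_eq_self_left hb' ?_
  rw [Finset.mul_sum]
  refine Fintype.sum_equiv (Equiv.addLeft b) _ _ fun a => ?_
  simp

variable [IsAlgClosed k] [CharZero k] [Finite A]

theorem hasEnoughRootsOfUnity_exponent :
    HasEnoughRootsOfUnity k (Monoid.exponent (Multiplicative A)) :=
  have : NeZero (Monoid.exponent (Multiplicative A)) := ⟨Monoid.exponent_ne_zero_of_finite⟩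
  have : NeZero ((Monoid.exponent (Multiplicative A) : ℕ) : k) := NeZero.charZero
  inferInstance

instance : Finite (CharGroup k A) :=
  have := hasEnoughRootsOfUnity_exponent (k := k) (A := A)
  Finite.of_equiv _
    ((CommGroup.monoidHom_mulEquiv_of_hasEnoughRootsOfUnity
      (Multiplicative A) k).some.toEquiv.symm.trans AddMonoidHom.toMultiplicativeLeft.symm)

theorem card_charGroup : Nat.card (CharGroup k A) = Nat.card A :=
  have := hasEnoughRootsOfUnity_exponent (k := k) (A := A)
  Nat.card_congr (AddMonoidHom.toMultiplicativeLeft.trans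
    (CommGroup.monoidHom_mulEquiv_of_hasEnoughRootsOfUnity (Multiplicative A) k).some.toEquiv)

theorem sum_charGroup_eq_zero [Fintype (CharGroup k A)] {a : A} (h : a ≠ 0) :
    ∑ χ : CharGroup k A, ((χ a).toMul : k) = 0 := by
  have := hasEnoughRootsOfUnity_exponent (k := k) (A := A)
  obtain ⟨ψ, hψ⟩ := CommGroup.exists_apply_ne_one_of_hasEnoughRootsOfUnity (Multiplicative A) k
    (a := Multiplicative.ofAdd a) (by simpa using h)
  let φ : CharGroup k A := MonoidHom.toAdditiveRight ψ
  have hφ : ((φ a).toMul : k) ≠ 1 := fun h' => hψ (Units.ext h')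
  refine eq_zero_of_mul_eq_self_left hφ ?_
  rw [Finset.mul_sum]
  refine Fintype.sum_equiv (Equiv.addLeft φ) _ _ fun a => ?_
  simp

end Characters

/-! ### The automorphisms of the identity functor defined by characters -/

section Twist

universe w v u uA

variable {C : Type u} [Category.{v} C] [MonoidalCategory C] [BraidedCategory C]
  [Preadditive C] [MonoidalPreadditive C]
  {k : Type w} [Field k] [Linear k C] [MonoidalLinear k C]
  {A : Type uA} [AddCommGroup A] {S : A → C}

namespace IsSimpleBasis

theorem exists_twist (H : IsSimpleBasis k S) (φ : CharGroup k A) :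
    ∃ τ : 𝟭 C ≅ 𝟭 C, ∀ a, τ.hom.app (S a) = ((φ a).toMul : k) • 𝟙 (S a) :=
  H.exists_natIso (𝟭 C) (𝟭 C) fun a => smulIso (φ a).toMul (Iso.refl (S a))

/-- The automorphism of the identity functor acting on `S a` by `φ a`. -/
noncomputable def twist (H : IsSimpleBasis k S) (φ : CharGroup k A) (X : C) : X ≅ X :=
  (H.exists_twist φ).choose.app X

theorem twist_naturality (H : IsSimpleBasis k S) (φ : CharGroup k A) {X Y : C} (f : X ⟶ Y) :
    f ≫ (H.twist φ Y).hom = (H.twist φ X).hom ≫ f :=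
  (H.exists_twist φ).choose.hom.naturality f

theorem twist_basis (H : IsSimpleBasis k S) (φ : CharGroup k A) (a : A) :
    (H.twist φ (S a)).hom = ((φ a).toMul : k) • 𝟙 (S a) :=
  (H.exists_twist φ).choose_spec a

theorem twist_of_iso (H : IsSimpleBasis k S) (φ : CharGroup k A) {X : C} {a : A} (e : X ≅ S a) :
    (H.twist φ X).hom = ((φ a).toMul : k) • 𝟙 X := by
  rw [← cancel_mono e.hom, ← H.twist_naturality, H.twist_basis]
  simp

theorem twist_add (H : IsSimpleBasis k S) (φ ψ : CharGroup k A) (X : C) :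
    (H.twist (φ + ψ) X).hom = (H.twist φ X).hom ≫ (H.twist ψ X).hom := by
  refine H.hom_ext fun a x => ?_
  rw [H.twist_naturality, reassoc_of% (H.twist_naturality φ x), H.twist_naturality, H.twist_basis,
    H.twist_basis, H.twist_basis]
  simp [smul_smul, mul_comm]

theorem twist_zero (H : IsSimpleBasis k S) (X : C) : (H.twist 0 X).hom = 𝟙 X := by
  refine H.hom_ext fun a x => ?_
  rw [H.twist_naturality, H.twist_basis]
  simp

theorem twist_tensor (H : IsSimpleBasis k S) (hS : ∀ a b, Nonempty (S a ⊗ S b ≅ S (a + b)))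
    (φ : CharGroup k A) (X Y : C) :
    (H.twist φ (X ⊗ Y)).hom = (H.twist φ X).hom ⊗ₘ (H.twist φ Y).hom := by
  refine Tensorator.tensor_hom_ext (F := 𝟭 C) H fun a b x y => ?_
  change (x ⊗ₘ y) ≫ (H.twist φ (X ⊗ Y)).hom =
    (x ⊗ₘ y) ≫ ((H.twist φ X).hom ⊗ₘ (H.twist φ Y).hom)
  rw [H.twist_naturality, tensorHom_comp_tensorHom, H.twist_naturality, H.twist_naturality,
    ← tensorHom_comp_tensorHom, H.twist_basis, H.twist_basis, H.twist_of_iso φ (hS a b).some,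
    map_add]
  simp [MonoidalCategory.tensorHom_def, smul_smul, mul_comm]

end IsSimpleBasis

end Twist

/-! ### Tensoring with invertible objects -/

section Invertible

universe v u

variable {C : Type u} [Category.{v} C] [MonoidalCategory C]

theorem whiskerRight_injective_of_iso {U V : C} (e : U ⊗ V ≅ 𝟙_ C) {X Y : C} {f g : X ⟶ Y}
    (h : f ▷ U = g ▷ U) : f = g := by
  have h1 : f ▷ (U ⊗ V) = g ▷ (U ⊗ V) := by
    rw [whiskerRight_tensor, whiskerRight_tensor, h]
  have h2 : ∀ f : X ⟶ Y,
      f = (ρ_ X).inv ≫ (X ◁ e.inv) ≫ (f ▷ (U ⊗ V)) ≫ (Y ◁ e.hom) ≫ (ρ_ Y).hom := by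
    intro f
    rw [whisker_exchange_assoc, ← MonoidalCategory.whiskerLeft_comp_assoc]
    simp
  rw [h2 f, h2 g, h1]

theorem whiskerRight_surjective_of_iso {U V : C} (e : U ⊗ V ≅ 𝟙_ C) (e' : V ⊗ U ≅ 𝟙_ C)
    {X Y : C} (g : X ⊗ U ⟶ Y ⊗ U) : ∃ f : X ⟶ Y, f ▷ U = g := by
  refine ⟨(ρ_ X).inv ≫ (X ◁ e.inv) ≫ (α_ _ _ _).inv ≫ (g ▷ V) ≫ (α_ _ _ _).hom ≫
    (Y ◁ e.hom) ≫ (ρ_ Y).hom, whiskerRight_injective_of_iso e' ?_⟩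
  rw [← cancel_epi (α_ X U V).inv, ← cancel_mono (α_ Y U V).hom, Category.assoc,
    ← whiskerRight_tensor]
  have h : ∀ f : X ⟶ Y, f ▷ (U ⊗ V) = (X ◁ e.hom) ≫ (ρ_ X).hom ≫ f ≫ (ρ_ Y).inv ≫ (Y ◁ e.inv) := by
    intro f
    rw [← cancel_mono (Y ◁ e.hom), ← whisker_exchange]
    simp
  rw [h]
  simp

end Invertible

/-! ### Lifts to the center -/

section Lift

universe w v u uA

variable {C : Type u} [Category.{v} C] [MonoidalCategory C] [BraidedCategory C]
  [Preadditive C] [MonoidalPreadditive C]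
  {k : Type w} [Field k] [Linear k C] [MonoidalLinear k C]
  {A : Type uA} [AddCommGroup A] {S : A → C}

namespace IsSimpleBasis

/-- The half-braiding of an object of a braided category, twisted by a character. -/
noncomputable def halfBraiding (H : IsSimpleBasis k S)
    (hS : ∀ a b, Nonempty (S a ⊗ S b ≅ S (a + b))) (φ : CharGroup k A) (X : C) :
    HalfBraiding X where
  β U := β_ X U ≪≫ whiskerRightIso (H.twist φ U) X
  monoidal U U' := by
    simp only [Iso.trans_hom, whiskerRightIso_hom, H.twist_tensor hS,
      BraidedCategory.braiding_tensor_right_hom, comp_whiskerRight, Category.assoc,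
      MonoidalCategory.whiskerLeft_comp]
    rw [MonoidalCategory.tensorHom_def, comp_whiskerRight,
      ← associator_inv_naturality_left_assoc, whisker_exchange_assoc,
      ← associator_naturality_left_assoc, ← associator_inv_naturality_middle]
  naturality f := by
    simp only [Iso.trans_hom, whiskerRightIso_hom, Category.assoc]
    rw [BraidedCategory.braiding_naturality_right_assoc, ← comp_whiskerRight,
      ← comp_whiskerRight, H.twist_naturality]

/-- The lift of an object of a braided category to the center defined by a character. -/
noncomputable abbrev lift (H : IsSimpleBasis k S)
    (hS : ∀ a b, Nonempty (S a ⊗ S b ≅ S (a + b))) (φ : CharGroup k A) (X : C) : Center C :=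
  ⟨X, H.halfBraiding hS φ X⟩

theorem halfBraiding_β_hom (H : IsSimpleBasis k S)
    (hS : ∀ a b, Nonempty (S a ⊗ S b ≅ S (a + b))) (φ : CharGroup k A) (X U : C) :
    ((H.halfBraiding hS φ X).β U).hom = (β_ X U).hom ≫ ((H.twist φ U).hom ▷ X) := rfl

/-- A morphism of the center is a morphism compatible with the half-braidings of the objects of a
basis. -/
theorem exists_centerHom (H : IsSimpleBasis k S) (Z W : Center C) (f : Z.1 ⟶ W.1)
    (hf : ∀ a, (f ▷ S a) ≫ (W.2.β (S a)).hom = (Z.2.β (S a)).hom ≫ (S a ◁ f)) :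
    ∃ g : Z ⟶ W, g.f = f := by
  refine ⟨⟨f, fun U => H.hom_ext_map (tensorLeft Z.1) fun a u => ?_⟩, rfl⟩
  change (Z.1 ◁ u) ≫ (f ▷ U) ≫ (W.2.β U).hom = (Z.1 ◁ u) ≫ (Z.2.β U).hom ≫ (U ◁ f)
  rw [whisker_exchange_assoc, HalfBraiding.naturality, reassoc_of% (hf a),
    HalfBraiding.naturality_assoc, whisker_exchange]

theorem halfBraiding_comm (H : IsSimpleBasis k S) (hS : ∀ a b, Nonempty (S a ⊗ S b ≅ S (a + b)))
    (φ : CharGroup k A) {X Y : C} (f : X ⟶ Y) (U : C) :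
    (f ▷ U) ≫ ((H.halfBraiding hS φ Y).β U).hom = ((H.halfBraiding hS φ X).β U).hom ≫ (U ◁ f) := by
  rw [halfBraiding_β_hom, halfBraiding_β_hom, BraidedCategory.braiding_naturality_left_assoc,
    Category.assoc,
    whisker_exchange]

/-- The half-braiding of a tensor product of lifts. -/
theorem halfBraiding_tensor (H : IsSimpleBasis k S) (hS : ∀ a b, Nonempty (S a ⊗ S b ≅ S (a + b)))
    (φ ψ : CharGroup k A) (X Y U : C) :
    (α_ X Y U).hom ≫ (X ◁ ((H.halfBraiding hS ψ Y).β U).hom) ≫ (α_ X U Y).inv ≫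
      (((H.halfBraiding hS φ X).β U).hom ▷ Y) ≫ (α_ U X Y).hom =
      ((H.halfBraiding hS (φ + ψ) (X ⊗ Y)).β U).hom := by
  rw [halfBraiding_β_hom, halfBraiding_β_hom, halfBraiding_β_hom, add_comm φ ψ, H.twist_add,
    BraidedCategory.braiding_tensor_left_hom]
  simp only [comp_whiskerRight, MonoidalCategory.whiskerLeft_comp, Category.assoc]
  simp only [associator_inv_naturality_middle_assoc, associator_naturality_left,
    ← comp_whiskerRight_assoc, BraidedCategory.braiding_naturality_right]
  simp only [comp_whiskerRight, Category.assoc, associator_naturality_left_assoc]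

/-- The tensor product of two lifts is a lift. -/
theorem nonempty_lift_tensor_iso (H : IsSimpleBasis k S)
    (hS : ∀ a b, Nonempty (S a ⊗ S b ≅ S (a + b))) (φ ψ : CharGroup k A) {X Y W : C}
    (e : X ⊗ Y ≅ W) : Nonempty (H.lift hS φ X ⊗ H.lift hS ψ Y ≅ H.lift hS (φ + ψ) W) := by
  let f : H.lift hS φ X ⊗ H.lift hS ψ Y ⟶ H.lift hS (φ + ψ) W :=
    ⟨e.hom, fun U => by
      have h := H.halfBraiding_comm hS (φ + ψ) e.hom U
      rw [← H.halfBraiding_tensor hS φ ψ X Y U] at h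
      exact h⟩
  have : IsIso f.f := inferInstanceAs (IsIso e.hom)
  exact ⟨asIso f⟩

theorem nonempty_unit_lift_iso (H : IsSimpleBasis k S)
    (hS : ∀ a b, Nonempty (S a ⊗ S b ≅ S (a + b))) {W : C} (e : 𝟙_ C ≅ W) :
    Nonempty (𝟙_ (Center C) ≅ H.lift hS 0 W) := by
  let f : 𝟙_ (Center C) ⟶ H.lift hS 0 W :=
    ⟨e.hom, fun U => by
      have h := H.halfBraiding_comm hS 0 e.hom U
      rw [H.halfBraiding_β_hom hS 0 (𝟙_ C), H.twist_zero, id_whiskerRight, Category.comp_id,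
        braiding_tensorUnit_left] at h
      exact h⟩
  have : IsIso f.f := inferInstanceAs (IsIso e.hom)
  exact ⟨asIso f⟩

/-- A dual of an object provides duals of its lifts. -/
@[reducible]
noncomputable def liftExactPairing (H : IsSimpleBasis k S)
    (hS : ∀ a b, Nonempty (S a ⊗ S b ≅ S (a + b))) (φ : CharGroup k A) (X Y : C)
    [ExactPairing X Y] : ExactPairing (H.lift hS φ X) (H.lift hS (-φ) Y) where
  coevaluation' := ⟨(η_ X Y : 𝟙_ C ⟶ X ⊗ Y), fun U => by
    have h := H.halfBraiding_comm hS 0 (η_ X Y : 𝟙_ C ⟶ X ⊗ Y) U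
    rw [H.halfBraiding_β_hom hS 0 (𝟙_ C), H.twist_zero, id_whiskerRight, Category.comp_id,
        braiding_tensorUnit_left, ← add_neg_cancel φ, ← H.halfBraiding_tensor hS φ (-φ)] at h
    exact h⟩
  evaluation' := ⟨(ε_ X Y : Y ⊗ X ⟶ 𝟙_ C), fun U => by
    have h := H.halfBraiding_comm hS 0 (ε_ X Y : Y ⊗ X ⟶ 𝟙_ C) U
    rw [H.halfBraiding_β_hom hS 0 (𝟙_ C), H.twist_zero, id_whiskerRight, Category.comp_id,
        braiding_tensorUnit_left, ← neg_add_cancel φ, ← H.halfBraiding_tensor hS (-φ) φ] at h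
    exact h⟩
  coevaluation_evaluation' := by
    ext
    simp only [Center.comp_f, Center.whiskerLeft_f, Center.whiskerRight_f,
      Center.associator_inv_f, Center.rightUnitor_hom_f, Center.leftUnitor_inv_f]
    exact ExactPairing.coevaluation_evaluation X Y
  evaluation_coevaluation' := by
    ext
    simp only [Center.comp_f, Center.whiskerLeft_f, Center.whiskerRight_f,
      Center.associator_hom_f, Center.leftUnitor_hom_f, Center.rightUnitor_inv_f]
    exact ExactPairing.evaluation_coevaluation X Y

end IsSimpleBasis

end Lift

end PointedCenter

namespace PointedCenter

/-! ### Direct sums in the center -/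

section Sums

universe v u v' u'

namespace SumData

variable {C : Type u} [Category.{v} C] [Preadditive C] {J : Type*} [Fintype J] {F : J → C} {X : C}

theorem hom_ext (d : SumData F X) {Y : C} {f g : X ⟶ Y} (h : ∀ j, d.ι j ≫ f = d.ι j ≫ g) :
    f = g := by
  rw [← Category.id_comp f, ← Category.id_comp g, ← d.total, Preadditive.sum_comp,
    Preadditive.sum_comp]
  exact Finset.sum_congr rfl fun j _ => by rw [Category.assoc, Category.assoc, h]

/-- The image of a direct sum under an additive functor. -/
def map (d : SumData F X) {D : Type u'} [Category.{v'} D] [Preadditive D] (G : C ⥤ D)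
    [G.Additive] : SumData (fun j => G.obj (F j)) (G.obj X) where
  ι j := G.map (d.ι j)
  π j := G.map (d.π j)
  ι_π j := by rw [← G.map_comp, d.ι_π, G.map_id]
  ι_π_ne i j h := by rw [← G.map_comp, d.ι_π_ne i j h, G.map_zero]
  total := by simp only [← G.map_comp, ← G.map_sum, d.total, G.map_id]

theorem ι_desc (d : SumData F X) {Y : C} (f : ∀ j, F j ⟶ Y) (j : J) :
    d.ι j ≫ ∑ l, d.π l ≫ f l = f j := by
  rw [Preadditive.comp_sum, Finset.sum_eq_single j]
  · rw [← Category.assoc, d.ι_π, Category.id_comp]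
  · intro l _ hl
    rw [← Category.assoc, d.ι_π_ne j l hl.symm, zero_comp]
  · simp

theorem lift_π (d : SumData F X) {Y : C} (f : ∀ j, Y ⟶ F j) (j : J) :
    (∑ l, f l ≫ d.ι l) ≫ d.π j = f j := by
  rw [Preadditive.sum_comp, Finset.sum_eq_single j]
  · rw [Category.assoc, d.ι_π, Category.comp_id]
  · intro l _ hl
    rw [Category.assoc, d.ι_π_ne l j hl, comp_zero]
  · simp

variable [MonoidalCategory C] [MonoidalPreadditive C]

/-- A direct sum of objects with right duals has a right dual. -/
@[reducible]
def exactPairing (d : SumData F X) {G : J → C} {Y : C} (d' : SumData G Y)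
    (e : ∀ j, ExactPairing (F j) (G j)) : ExactPairing X Y :=
  let η : 𝟙_ C ⟶ X ⊗ Y := ∑ j, η_ (F j) (G j) ≫ (F j ◁ d'.ι j) ≫ (d.ι j ▷ Y)
  let ε : Y ⊗ X ⟶ 𝟙_ C := ∑ j, (d'.π j ▷ X) ≫ (G j ◁ d.π j) ≫ ε_ (F j) (G j)
  have h₁ : ∀ j, η ≫ (d.π j ▷ Y) = η_ (F j) (G j) ≫ (F j ◁ d'.ι j) := fun j => by
    have := (d.map (tensorRight Y)).lift_π (fun j => η_ (F j) (G j) ≫ (F j ◁ d'.ι j)) j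
    change (∑ l, (η_ (F l) (G l) ≫ (F l ◁ d'.ι l)) ≫ (d.ι l ▷ Y)) ≫ (d.π j ▷ Y) = _ at this
    simpa only [Category.assoc] using this
  have h₂ : ∀ j, (d'.ι j ▷ X) ≫ ε = (G j ◁ d.π j) ≫ ε_ (F j) (G j) := fun j =>
    (d'.map (tensorRight X)).ι_desc (fun j => (G j ◁ d.π j) ≫ ε_ (F j) (G j)) j
  have h₃ : ∀ j, η ≫ (X ◁ d'.π j) = η_ (F j) (G j) ≫ (d.ι j ▷ G j) := fun j => by
    have := (d'.map (tensorLeft X)).lift_π (fun j => η_ (F j) (G j) ≫ (d.ι j ▷ G j)) j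
    change (∑ l, (η_ (F l) (G l) ≫ (d.ι l ▷ G l)) ≫ (X ◁ d'.ι l)) ≫ (X ◁ d'.π j) = _ at this
    simpa only [Category.assoc, ← whisker_exchange] using this
  have h₄ : ∀ j, (Y ◁ d.ι j) ≫ ε = (d'.π j ▷ F j) ≫ ε_ (F j) (G j) := fun j => by
    have := (d.map (tensorLeft Y)).ι_desc (fun j => (d'.π j ▷ F j) ≫ ε_ (F j) (G j)) j
    change (Y ◁ d.ι j) ≫ ∑ l, (Y ◁ d.π l) ≫ (d'.π l ▷ F l) ≫ ε_ (F l) (G l) = _ at this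
    simpa only [whisker_exchange_assoc] using this
  { coevaluation' := η
    evaluation' := ε
    coevaluation_evaluation' := by
      refine (d'.map (tensorRight (𝟙_ C))).hom_ext fun j => ?_
      change (d'.ι j ▷ 𝟙_ C) ≫ (Y ◁ η) ≫ (α_ Y X Y).inv ≫ (ε ▷ Y) =
        (d'.ι j ▷ 𝟙_ C) ≫ (ρ_ Y).hom ≫ (λ_ Y).inv
      rw [← whisker_exchange_assoc, associator_inv_naturality_left_assoc, ← comp_whiskerRight, h₂,
        comp_whiskerRight, ← associator_inv_naturality_middle_assoc,
        ← MonoidalCategory.whiskerLeft_comp_assoc, h₁, MonoidalCategory.whiskerLeft_comp_assoc,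
        associator_inv_naturality_right_assoc, whisker_exchange,
        ExactPairing.coevaluation_evaluation_assoc]
      simp
    evaluation_coevaluation' := by
      refine (d.map (tensorLeft (𝟙_ C))).hom_ext fun j => ?_
      change (𝟙_ C ◁ d.ι j) ≫ (η ▷ X) ≫ (α_ X Y X).hom ≫ (X ◁ ε) =
        (𝟙_ C ◁ d.ι j) ≫ (λ_ X).hom ≫ (ρ_ X).inv
      rw [whisker_exchange_assoc, associator_naturality_right_assoc,
        ← MonoidalCategory.whiskerLeft_comp, h₄, MonoidalCategory.whiskerLeft_comp,
        ← associator_naturality_middle_assoc, ← comp_whiskerRight_assoc, h₃,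
        comp_whiskerRight_assoc, associator_naturality_left_assoc, ← whisker_exchange,
        ExactPairing.evaluation_coevaluation_assoc]
      simp }

/-- The half-braiding of a direct sum. -/
def halfBraiding {J : Type*} [Fintype J] {F : J → C} (hF : ∀ j, HalfBraiding (F j)) {X : C}
    (d : SumData F X) : HalfBraiding X :=
  let b : ∀ U, X ⊗ U ⟶ U ⊗ X := fun U =>
    ∑ j, (d.π j ▷ U) ≫ ((hF j).β U).hom ≫ (U ◁ d.ι j)
  let b' : ∀ U, U ⊗ X ⟶ X ⊗ U := fun U =>
    ∑ j, (U ◁ d.π j) ≫ ((hF j).β U).inv ≫ (d.ι j ▷ U)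
  have h : ∀ U j, (d.ι j ▷ U) ≫ b U = ((hF j).β U).hom ≫ (U ◁ d.ι j) := fun U j =>
    (d.map (tensorRight U)).ι_desc (fun j => ((hF j).β U).hom ≫ (U ◁ d.ι j)) j
  have h' : ∀ U j, (U ◁ d.ι j) ≫ b' U = ((hF j).β U).inv ≫ (d.ι j ▷ U) := fun U j =>
    (d.map (tensorLeft U)).ι_desc (fun j => ((hF j).β U).inv ≫ (d.ι j ▷ U)) j
  { β := fun U =>
      { hom := b U
        inv := b' U
        hom_inv_id := (d.map (tensorRight U)).hom_ext fun j => by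
          change (d.ι j ▷ U) ≫ b U ≫ b' U = (d.ι j ▷ U) ≫ 𝟙 _
          rw [reassoc_of% (h U j), h', Iso.hom_inv_id_assoc, Category.comp_id]
        inv_hom_id := (d.map (tensorLeft U)).hom_ext fun j => by
          change (U ◁ d.ι j) ≫ b' U ≫ b U = (U ◁ d.ι j) ≫ 𝟙 _
          rw [reassoc_of% (h' U j), h, Iso.inv_hom_id_assoc, Category.comp_id] }
    monoidal := fun U U' => (d.map (tensorRight (U ⊗ U'))).hom_ext fun j => by
      change (d.ι j ▷ (U ⊗ U')) ≫ b (U ⊗ U') = (d.ι j ▷ (U ⊗ U')) ≫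
        (α_ _ _ _).inv ≫ (b U ▷ U') ≫ (α_ _ _ _).hom ≫ (U ◁ b U') ≫ (α_ _ _ _).inv
      rw [h, HalfBraiding.monoidal, associator_inv_naturality_left_assoc,
        ← comp_whiskerRight_assoc, h, comp_whiskerRight_assoc, associator_naturality_middle_assoc,
        ← MonoidalCategory.whiskerLeft_comp_assoc, h, MonoidalCategory.whiskerLeft_comp_assoc]
      simp only [Category.assoc, associator_inv_naturality_right]
    naturality := fun {U U'} f => (d.map (tensorRight U)).hom_ext fun j => by
      change (d.ι j ▷ U) ≫ (X ◁ f) ≫ b U' = (d.ι j ▷ U) ≫ b U ≫ (f ▷ X)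
      rw [← whisker_exchange_assoc, h, reassoc_of% (h U j), HalfBraiding.naturality_assoc,
        whisker_exchange] }

theorem ι_halfBraiding {J : Type*} [Fintype J] {F : J → C} (hF : ∀ j, HalfBraiding (F j)) {X : C}
    (d : SumData F X) (U : C) (j : J) :
    (d.ι j ▷ U) ≫ ((halfBraiding hF d).β U).hom = ((hF j).β U).hom ≫ (U ◁ d.ι j) :=
  (d.map (tensorRight U)).ι_desc (fun j => ((hF j).β U).hom ≫ (U ◁ d.ι j)) j

theorem halfBraiding_π {J : Type*} [Fintype J] {F : J → C} (hF : ∀ j, HalfBraiding (F j)) {X : C}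
    (d : SumData F X) (U : C) (j : J) :
    (d.π j ▷ U) ≫ ((hF j).β U).hom = ((halfBraiding hF d).β U).hom ≫ (U ◁ d.π j) := by
  have := (d.map (tensorLeft U)).lift_π (fun j => (d.π j ▷ U) ≫ ((hF j).β U).hom) j
  simp only [Category.assoc] at this
  exact this.symm

end SumData

variable {C : Type u} [Category.{v} C] [Preadditive C] [MonoidalCategory C]
  [MonoidalPreadditive C]

instance : (Center.forget C).Additive where
  map_add := rfl

theorem center_sum_f {J : Type*} (s : Finset J) {X Y : Center C} (f : J → (X ⟶ Y)) :
    (∑ j ∈ s, f j).f = ∑ j ∈ s, (f j).f :=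
  (Center.forget C).map_sum f s

/-- Direct sums in the center are computed in the underlying category. -/
def SumData.center {J : Type*} [Fintype J] {F : J → Center C} {X : Center C}
    (d : SumData (fun j => (F j).1) X.1)
    (hι : ∀ j U, (d.ι j ▷ U) ≫ (X.2.β U).hom = ((F j).2.β U).hom ≫ (U ◁ d.ι j))
    (hπ : ∀ j U, (d.π j ▷ U) ≫ ((F j).2.β U).hom = (X.2.β U).hom ≫ (U ◁ d.π j)) :
    SumData F X where
  ι j := ⟨d.ι j, hι j⟩
  π j := ⟨d.π j, hπ j⟩
  ι_π j := Center.ext _ _ (d.ι_π j)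
  ι_π_ne i j h := Center.ext _ _ (d.ι_π_ne i j h)
  total := Center.ext _ _ (by rw [center_sum_f]; exact d.total)

theorem center_exists_sumData [HasFiniteBiproducts C] {n : ℕ} (F : Fin n → Center C) :
    ∃ X : Center C, Nonempty (SumData F X) := by
  let d := SumData.ofBicone _ (biproduct.isBilimit fun j => (F j).1)
  let X : Center C := ⟨_, SumData.halfBraiding (fun j => (F j).2) d⟩
  exact ⟨X, ⟨SumData.center (F := F) (X := X) d
    (fun j U => SumData.ι_halfBraiding (fun j => (F j).2) d U j)
    fun j U => SumData.halfBraiding_π (fun j => (F j).2) d U j⟩⟩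

instance [HasFiniteBiproducts C] : HasFiniteBiproducts (Center C) where
  out n :=
    { has_biproduct := fun F => by
        obtain ⟨X, ⟨d⟩⟩ := center_exists_sumData F
        exact HasBiproduct.mk ⟨d.bicone, d.isBilimit⟩ }

end Sums

end PointedCenter

namespace PointedCenter

/-! ### Isotypic decomposition of an action of a finite abelian group -/

section Isotypic

universe w v u uA

variable {C : Type u} [Category.{v} C] [Preadditive C] {k : Type w} [Field k] [IsAlgClosed k]
  [CharZero k] [Linear k C] {A : Type uA} [AddCommGroup A] [Finite A]

theorem exists_sumData_of_action [IsIdempotentComplete C] [Fintype (CharGroup k A)] {X : C}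
    (ρ : A → (X ⟶ X)) (hadd : ∀ a b, ρ (a + b) = ρ a ≫ ρ b) (h0 : ρ 0 = 𝟙 X) :
    ∃ (Y : CharGroup k A → C) (d : SumData Y X),
      (∀ φ b, d.ι φ ≫ ρ b = ((φ b).toMul : k) • d.ι φ) ∧
      (∀ φ b, ρ b ≫ d.π φ = ((φ b).toMul : k) • d.π φ) := by
  classical
  have := Fintype.ofFinite A
  have hN : (Fintype.card A : k) ≠ 0 := by simp
  let e : CharGroup k A → (X ⟶ X) := fun φ =>
    (Fintype.card A : k)⁻¹ • ∑ b, ((φ (-b)).toMul : k) • ρ b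
  have he₁ : ∀ φ c, e φ ≫ ρ c = ((φ c).toMul : k) • e φ := fun φ c => by
    simp only [e, Linear.smul_comp, Preadditive.sum_comp, ← hadd]
    rw [smul_comm, Finset.smul_sum (r := ((φ c).toMul : k))]
    congr 1
    refine Fintype.sum_equiv (Equiv.addRight c) _ _ fun b => ?_
    simp [smul_smul]
  have he₂ : ∀ φ c, ρ c ≫ e φ = ((φ c).toMul : k) • e φ := fun φ c => by
    simp only [e, Linear.comp_smul, Preadditive.comp_sum, ← hadd, add_comm c]
    rw [smul_comm, Finset.smul_sum (r := ((φ c).toMul : k))]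
    congr 1
    refine Fintype.sum_equiv (Equiv.addRight c) _ _ fun b => ?_
    simp [smul_smul]
  have he : ∀ φ ψ, e φ ≫ e ψ =
      ((Fintype.card A : k)⁻¹ * ∑ b, (((φ - ψ) b).toMul : k)) • e φ := fun φ ψ => by
    change e φ ≫ ((Fintype.card A : k)⁻¹ • ∑ b, ((ψ (-b)).toMul : k) • ρ b) = _
    rw [Linear.comp_smul, Preadditive.comp_sum, mul_smul, Finset.sum_smul]
    congr 1
    refine Finset.sum_congr rfl fun b _ => ?_
    rw [Linear.comp_smul, he₁, smul_smul]
    simp [div_eq_mul_inv, mul_comm]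
  have hee : ∀ φ, e φ ≫ e φ = e φ := fun φ => by
    rw [he]
    simp [hN]
  have hne : ∀ φ ψ, φ ≠ ψ → e φ ≫ e ψ = 0 := fun φ ψ h => by
    rw [he, sum_char_eq_zero (sub_ne_zero.2 h), mul_zero, zero_smul]
  have htot : ∑ φ, e φ = 𝟙 X := by
    simp only [e]
    rw [← Finset.smul_sum, Finset.sum_comm]
    simp only [← Finset.sum_smul]
    rw [Finset.sum_eq_single 0]
    · have := card_charGroup (k := k) (A := A)
      rw [Nat.card_eq_fintype_card, Nat.card_eq_fintype_card] at this
      simp [h0, this, smul_smul, hN]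
    · intro b _ hb
      rw [sum_charGroup_eq_zero (neg_ne_zero.2 hb), zero_smul]
    · simp
  choose Y i r hir hri using fun φ => IsIdempotentComplete.idempotents_split X (e φ) (hee φ)
  have hie : ∀ φ, i φ ≫ e φ = i φ := fun φ => by
    rw [← hri, reassoc_of% (hir φ)]
  have her : ∀ φ, e φ ≫ r φ = r φ := fun φ => by
    rw [← hri, Category.assoc, hir, Category.comp_id]
  refine ⟨Y, ⟨i, r, hir, fun φ ψ h => ?_, by simp only [hri, htot]⟩, fun φ b => ?_, fun φ b => ?_⟩
  · rw [← hie, ← her ψ, Category.assoc, reassoc_of% (hne φ ψ h), zero_comp, comp_zero]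
  · change i φ ≫ ρ b = _ • i φ
    rw [← hie, Category.assoc, he₁, Linear.comp_smul]
  · change ρ b ≫ r φ = _ • r φ
    rw [← her, ← Category.assoc, he₂, Linear.smul_comp]

end Isotypic

/-! ### The simple objects of the center -/

section CenterBasis

universe w v u uA

variable {C : Type u} [Category.{v} C] [MonoidalCategory C] [BraidedCategory C]
  [Preadditive C] [MonoidalPreadditive C]
  {k : Type w} [Field k] [Linear k C] [MonoidalLinear k C]
  {A : Type uA} [AddCommGroup A] {S : A → C}

namespace IsSimpleBasis

theorem nonempty_tensor_iso_unit (hS : ∀ a b, Nonempty (S a ⊗ S b ≅ S (a + b)))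
    (h0 : Nonempty (𝟙_ C ≅ S 0)) {a b : A} (h : a + b = 0) : Nonempty (S a ⊗ S b ≅ 𝟙_ C) :=
  ⟨(hS a b).some ≪≫ eqToIso (by rw [h]) ≪≫ h0.some.symm⟩

/-- Compared with the braiding, a half-braiding amounts to an action of the group of simple
objects. -/
theorem exists_action (hS : ∀ a b, Nonempty (S a ⊗ S b ≅ S (a + b)))
    (h0 : Nonempty (𝟙_ C ≅ S 0)) {X : C} (b : HalfBraiding X) :
    ∃ ρ : A → (X ⟶ X), (∀ a, (b.β (S a)).hom = (ρ a ▷ S a) ≫ (β_ X (S a)).hom) ∧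
      (∀ a b, ρ (a + b) = ρ a ≫ ρ b) ∧ ρ 0 = 𝟙 X := by
  have inv : ∀ a, Nonempty (S a ⊗ S (-a) ≅ 𝟙_ C) ∧ Nonempty (S (-a) ⊗ S a ≅ 𝟙_ C) := fun a =>
    ⟨nonempty_tensor_iso_unit hS h0 (by simp), nonempty_tensor_iso_unit hS h0 (by simp)⟩
  choose ρ hρ using fun a => whiskerRight_surjective_of_iso (inv a).1.some (inv a).2.some
    ((b.β (S a)).hom ≫ (β_ X (S a)).inv)
  replace hρ : ∀ a, (b.β (S a)).hom = (ρ a ▷ S a) ≫ (β_ X (S a)).hom := fun a => by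
    rw [hρ, Category.assoc, Iso.inv_hom_id, Category.comp_id]
  have hρ' : ∀ {a U} (_ : U ≅ S a), (b.β U).hom = (ρ a ▷ U) ≫ (β_ X U).hom := fun {a U} e => by
    rw [← cancel_mono (e.hom ▷ X), ← b.naturality, hρ, whisker_exchange_assoc, Category.assoc,
      BraidedCategory.braiding_naturality_right]
  have hadd : ∀ a b, ρ (a + b) = ρ a ≫ ρ b := fun a a' => by
    refine whiskerRight_injective_of_iso (inv (a + a')).1.some ?_
    rw [← cancel_epi (X ◁ (hS a a').some.hom), whisker_exchange, whisker_exchange]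
    congr 1
    rw [← cancel_mono (β_ X (S a ⊗ S a')).hom, ← hρ' (hS a a').some, b.monoidal, hρ, hρ,
      BraidedCategory.braiding_tensor_right_hom]
    simp only [comp_whiskerRight, MonoidalCategory.whiskerLeft_comp, Category.assoc,
      whiskerRight_tensor, Iso.hom_inv_id_assoc]
    rw [← associator_naturality_middle_assoc, ← comp_whiskerRight_assoc (β_ X (S a)).hom,
      ← BraidedCategory.braiding_naturality_left, comp_whiskerRight_assoc]
  refine ⟨ρ, hρ, hadd, whiskerRight_injective_of_iso (inv 0).1.some ?_⟩
  have h1 : ρ 0 ▷ S 0 = (b.β (S 0)).hom ≫ (β_ X (S 0)).inv := by simp [hρ]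
  have : IsIso (ρ 0 ▷ S 0) := by rw [h1]; infer_instance
  rw [← cancel_epi (ρ 0 ▷ S 0), ← comp_whiskerRight, ← hadd]
  simp

variable [IsAlgClosed k] [CharZero k] [Finite A]

/-- Every object of the center is a direct sum of lifts. -/
theorem exists_sumData_lift [IsIdempotentComplete C] [Fintype (CharGroup k A)]
    (H : IsSimpleBasis k S)
    (hS : ∀ a b, Nonempty (S a ⊗ S b ≅ S (a + b))) (h0 : Nonempty (𝟙_ C ≅ S 0)) (Z : Center C) :
    ∃ Y : CharGroup k A → C, Nonempty (SumData (fun φ => H.lift hS φ (Y φ)) Z) := by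
  obtain ⟨X, b⟩ := Z
  obtain ⟨ρ, hρ, hadd, hρ0⟩ := exists_action hS h0 b
  obtain ⟨Y, d, hι, hπ⟩ := exists_sumData_of_action (k := k) ρ hadd hρ0
  let Z : Center C := ⟨X, b⟩
  change ∃ Y : CharGroup k A → C, Nonempty (SumData (fun φ => H.lift hS φ (Y φ)) Z)
  have h₁ : ∀ φ, ∃ g : H.lift hS φ (Y φ) ⟶ Z, g.f = d.ι φ := fun φ =>
    H.exists_centerHom (H.lift hS φ (Y φ)) Z (d.ι φ) fun a => by
      change (d.ι φ ▷ S a) ≫ (b.β (S a)).hom =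
        ((H.halfBraiding hS φ (Y φ)).β (S a)).hom ≫ (S a ◁ d.ι φ)
      rw [hρ, ← comp_whiskerRight_assoc, hι, halfBraiding_β_hom, H.twist_basis]
      simp
  have h₂ : ∀ φ, ∃ g : Z ⟶ H.lift hS φ (Y φ), g.f = d.π φ := fun φ =>
    H.exists_centerHom Z (H.lift hS φ (Y φ)) (d.π φ) fun a => by
      change (d.π φ ▷ S a) ≫ ((H.halfBraiding hS φ (Y φ)).β (S a)).hom =
        (b.β (S a)).hom ≫ (S a ◁ d.π φ)
      rw [hρ, Category.assoc, ← BraidedCategory.braiding_naturality_left, ← comp_whiskerRight_assoc,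
        hπ, halfBraiding_β_hom, H.twist_basis]
      simp
  choose i hi using h₁
  choose r hr using h₂
  exact ⟨Y, ⟨⟨i, r, fun φ => Center.ext _ _ (by rw [Center.comp_f, hi, hr]; exact d.ι_π φ),
    fun φ ψ h => Center.ext _ _ (by rw [Center.comp_f, hi, hr]; exact d.ι_π_ne φ ψ h),
    Center.ext _ _ (by
      rw [center_sum_f]
      simp only [Center.comp_f, hi, hr]
      exact d.total)⟩⟩⟩

/-- A direct sum decomposition lifts to the center. -/
noncomputable def liftSumData (H : IsSimpleBasis k S)
    (hS : ∀ a b, Nonempty (S a ⊗ S b ≅ S (a + b))) (φ : CharGroup k A) {J : Type*} [Fintype J]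
    {F : J → C} {X : C} (d : SumData F X) :
    SumData (fun j => H.lift hS φ (F j)) (H.lift hS φ X) :=
  SumData.center (F := fun j => H.lift hS φ (F j)) (X := H.lift hS φ X) d
    (fun j U => H.halfBraiding_comm hS φ (d.ι j) U)
    (fun j U => H.halfBraiding_comm hS φ (d.π j) U)

/-- The simple objects of the center. -/
noncomputable def centerSimple (H : IsSimpleBasis k S)
    (hS : ∀ a b, Nonempty (S a ⊗ S b ≅ S (a + b))) (p : A × CharGroup k A) : Center C :=
  H.lift hS p.2 (S p.1)

theorem center [IsIdempotentComplete C] (H : IsSimpleBasis k S)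
    (hS : ∀ a b, Nonempty (S a ⊗ S b ≅ S (a + b))) (h0 : Nonempty (𝟙_ C ≅ S 0)) :
    IsSimpleBasis k (H.centerSimple hS) where
  id_ne_zero p h := H.id_ne_zero p.1 (congrArg Center.Hom.f h)
  schur p f := by
    obtain ⟨c, hc⟩ := H.schur p.1 f.f
    exact ⟨c, Center.ext _ _ hc⟩
  hom_eq_zero := by
    rintro ⟨a, φ⟩ ⟨b, ψ⟩ h f
    rcases eq_or_ne a b with rfl | hab
    · obtain ⟨c, hc⟩ := H.schur a f.f
      have hφ : φ ≠ ψ := fun h' => h (by rw [h'])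
      obtain ⟨b, hb⟩ : ∃ b, φ b ≠ ψ b := by
        by_contra! h'
        exact hφ (AddMonoidHom.ext h')
      have key : ∀ g : S a ⟶ S a, g = c • 𝟙 (S a) →
          (g ▷ S b) ≫ ((H.halfBraiding hS ψ (S a)).β (S b)).hom =
            ((H.halfBraiding hS φ (S a)).β (S b)).hom ≫ (S b ◁ g) →
          (((ψ b).toMul : k) * c) • (β_ (S a) (S b)).hom =
            (((φ b).toMul : k) * c) • (β_ (S a) (S b)).hom := by
        rintro g rfl hg
        rw [halfBraiding_β_hom, halfBraiding_β_hom, H.twist_basis, H.twist_basis] at hg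
        simpa [smul_smul, mul_comm] using hg
      have h1 := key f.f hc (f.comm (S b))
      have h2 : ((((ψ b).toMul : k) - (φ b).toMul) * c) • 𝟙 (S a ⊗ S b) = 0 := by
        rw [← cancel_mono (β_ (S a) (S b)).hom, zero_comp, Linear.smul_comp, Category.id_comp,
          sub_mul, sub_smul, h1, sub_self]
      have h3 : 𝟙 (S a ⊗ S b) ≠ 0 := fun h3 => H.id_ne_zero (a + b) (by
        rw [← (hS a b).some.inv_hom_id, ← Category.id_comp (hS a b).some.hom, h3, zero_comp,
          comp_zero])
      rcases mul_eq_zero.1 ((smul_eq_zero.1 h2).resolve_right h3) with h4 | h4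
      · exact absurd (Units.ext (sub_eq_zero.1 h4)).symm hb
      · exact Center.ext _ _ (by rw [hc, h4, zero_smul]; rfl)
    · exact Center.ext _ _ (H.hom_eq_zero a b hab f.f)
  exists_sumData Z := by
    have := Fintype.ofFinite (CharGroup k A)
    obtain ⟨Y, ⟨d⟩⟩ := H.exists_sumData_lift hS h0 Z
    choose n s d' using fun φ => H.exists_sumData (Y φ)
    let e := (Fintype.equivFin (Σ φ, Fin (n φ))).symm
    exact ⟨_, fun j => (s (e j).1 (e j).2, (e j).1),
      ⟨(d.sigma fun φ => H.liftSumData hS φ (d' φ).some).reindex e⟩⟩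

theorem nonempty_rigid_center [HasFiniteBiproducts C] [IsIdempotentComplete C]
    [RightRigidCategory C] (H : IsSimpleBasis k S)
    (hS : ∀ a b, Nonempty (S a ⊗ S b ≅ S (a + b))) (h0 : Nonempty (𝟙_ C ≅ S 0)) :
    Nonempty (RigidCategory (Center C)) := by
  have (Z : Center C) : Nonempty (HasRightDual Z) := by
    obtain ⟨n, s, ⟨d⟩⟩ := (H.center hS h0).exists_sumData Z
    obtain ⟨Y, ⟨d'⟩⟩ := center_exists_sumData fun j => H.lift hS (-(s j).2) (S (s j).1)ᘁ
    exact ⟨{ rightDual := Y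
             exact := d.exactPairing d' fun j =>
              H.liftExactPairing hS (s j).2 (S (s j).1) (S (s j).1)ᘁ }⟩
  let _ : RightRigidCategory (Center C) := { rightDual := fun Z => (this Z).some }
  exact ⟨BraidedCategory.rigidCategoryOfRightRigidCategory⟩

end IsSimpleBasis

end CenterBasis

end PointedCenter

namespace PointedCenter

section Main

universe w v u uA

theorem IsQuadraticForm.centerForm {k : Type w} [Field k] {A : Type u} [AddCommGroup A]
    {q : A → kˣ} (hq : IsQuadraticForm q) : IsQuadraticForm (centerForm q) where
  map_neg := by
    rintro ⟨a, φ⟩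
    simp [PointedCenter.centerForm, hq.map_neg]
  map_add_left := by
    rintro ⟨a, φ⟩ ⟨b, ψ⟩ ⟨c, χ⟩
    have h := congrArg Additive.ofMul (hq.map_add_left a b c)
    apply Additive.ofMul.injective
    simp only [PointedCenter.centerForm, Prod.mk_add_mk, map_add, AddMonoidHom.add_apply,
      ofMul_mul, ofMul_div, ofMul_toMul] at h ⊢
    linear_combination (norm := abel_nf) h
  map_add_right := by
    rintro ⟨a, φ⟩ ⟨b, ψ⟩ ⟨c, χ⟩
    have h := congrArg Additive.ofMul (hq.map_add_right a b c)
    apply Additive.ofMul.injective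
    simp only [PointedCenter.centerForm, Prod.mk_add_mk, map_add, AddMonoidHom.add_apply,
      ofMul_mul, ofMul_div, ofMul_toMul] at h ⊢
    linear_combination (norm := abel_nf) h

variable {C : Type u} [Category.{v} C] [Preadditive C] {k : Type w} [Field k] [IsAlgClosed k]
  [CharZero k] [Linear k C] [MonoidalCategory C] [MonoidalPreadditive C] [MonoidalLinear k C]
  [BraidedCategory C] {A : Type uA} [AddCommGroup A] [Finite A] {q : A → kˣ}

theorem IsAbelian.isIdempotentComplete {C : Type u} [Category.{v} C] [Preadditive C]
    (h : IsAbelian C) : IsIdempotentComplete C := by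
  obtain ⟨_, _, _, _, _⟩ := h
  let _ : Abelian C := {}
  infer_instance

/-- The center of a pointed braided fusion category. -/
theorem IsPointedBraidedFusion.center (hC : IsPointedBraidedFusion k C A q) :
    IsPointedBraidedFusion k (Center C) (A × CharGroup k A) (centerForm q) := by
  obtain ⟨S, hS₁, hS₂, hS₃, hS, hSq⟩ := hC.hasInvariant
  have H := hC.isFusion.isSimpleBasis S hS₁ hS₂ hS₃
  have h0 := H.nonempty_unit_iso hS hC.isFusion.simple_unit
  have := hC.isFusion.isAbelian.isIdempotentComplete
  have := hC.isFusion.isAbelian.hasFiniteProducts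
  have : HasFiniteBiproducts C := HasFiniteBiproducts.of_hasFiniteProducts
  obtain ⟨_⟩ := hC.isFusion.rigid
  have HZ := H.center hS h0
  have tens : ∀ p p', Nonempty (H.centerSimple hS p ⊗ H.centerSimple hS p' ≅
      H.centerSimple hS (p + p')) := fun p p' =>
    H.nonempty_lift_tensor_iso hS p.2 p'.2 (hS p.1 p'.1).some
  have unit : Nonempty (𝟙_ (Center C) ≅ H.centerSimple hS 0) :=
    H.nonempty_unit_lift_iso hS h0.some
  refine ⟨HZ.isFusionCategory (H.nonempty_rigid_center hS h0) 0 unit, fun Z hZ => ?_,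
    H.centerSimple hS, HZ.simple, fun Z _ => HZ.exists_iso_of_simple Z,
    fun p p' ⟨e⟩ => HZ.eq_of_iso e, tens, fun p => ?_⟩
  · obtain ⟨p, ⟨e⟩⟩ := HZ.exists_iso_of_simple Z
    exact ⟨H.centerSimple hS (-p),
      ⟨whiskerRightIso e _ ≪≫
        (IsSimpleBasis.nonempty_tensor_iso_unit tens unit (add_neg_cancel p)).some⟩,
      ⟨whiskerLeftIso _ e ≪≫
        (IsSimpleBasis.nonempty_tensor_iso_unit tens unit (neg_add_cancel p)).some⟩⟩
  · refine Center.ext _ _ ?_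
    change ((H.halfBraiding hS p.2 (S p.1)).β (S p.1)).hom =
      (centerForm q p : k) • 𝟙 (S p.1 ⊗ S p.1)
    rw [H.halfBraiding_β_hom, hSq, H.twist_basis]
    simp [centerForm, smul_smul, mul_comm]

end Main

end PointedCenter

theorem mainTheorem10
    (k : Type*) [Field k] [IsAlgClosed k] [CharZero k]
    (A : Type*) [AddCommGroup A] [Finite A]
    (q : A → kˣ) (hq : PointedCenter.IsQuadraticForm q)
    (C : Type*) [Category* C] [Preadditive C] [Linear k C] [MonoidalCategory C]
    [MonoidalPreadditive C] [MonoidalLinear k C] [BraidedCategory C]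
    (hC : PointedCenter.IsPointedBraidedFusion k C A q) :
    PointedCenter.IsFusionCategory k (Center C) ∧
    PointedCenter.IsPointed (Center C) ∧
    PointedCenter.IsQuadraticForm (PointedCenter.centerForm q) ∧
    PointedCenter.HasInvariant k (Center C)
      (A × PointedCenter.CharGroup k A) (PointedCenter.centerForm q) ∧
    ∀ (D : Type*) [Category* D] [Preadditive D] [Linear k D] [MonoidalCategory D]
      [MonoidalPreadditive D] [MonoidalLinear k D] [BraidedCategory D],
      PointedCenter.IsPointedBraidedFusion k D
        (A × PointedCenter.CharGroup k A) (PointedCenter.centerForm q) →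
      PointedCenter.BraidedEquivalent k (Center C) D := by
  have h := hC.center
  exact ⟨h.isFusion, h.isPointed, hq.centerForm, h.hasInvariant, fun D _ _ _ _ _ _ _ hD =>
    h.braidedEquivalent hD⟩
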